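/- Let $L,\upsilon_0,\sigma_{\mathtt s},\sigma_{\mathtt f}\in(0,\infty)$, $D=(-L,L)$ and $V=\{-\upsilon_0,\upsilon_0\}$. Let $L_\infty^+(D\times V)$ be the set of non-negative, bounded, measurable functions on $D\times V$, and $\langle f,g\rangle=\sum_{\upsilon\in V}\int_{-L}^{L}f(r,\upsilon)g(r,\upsilon)\,dr$. Consider scattering $\mathtt S f(r,\upsilon)=\sigma_{\mathtt s}(f(r,-\upsilon)-f(r,\upsilon))$, binary fission $\mathtt F f(r,\upsilon)=\sigma_{\mathtt f}(2f(r,\upsilon)-f(r,\upsilon))$, and the advection semigroup $\mathtt U_t[g](r,\upsilon)=g(r+\upsilon t,\upsilon)\mathbf 1_{\{t<\kappa_{r,\upsilon}\}}$ with $\kappa_{r,\upsilon}=\inf\{t>0:r+\upsilon t\notin D\}$. Let $(\psi_t)_{t\ge0}$ be the semigroup identified by the mild neutron transport equation: for $g\in L_\infty^+(D\times V)$, $\psi_t[g](r,\upsilon)$ is measurable in $(t,r)$, bounded on bounded time intervals, and $$\psi_t[g]=\mathtt U_t[g]+\int_0^t\mathtt U_s\big[(\mathtt S+\mathtt F)\psi_{t-s}[g]\big]\,ds\quad\text{on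 }D\times V,\qquad t\ge0 .$$ A \emph{leading eigentriple} is $(\lambda_*,\varphi,\tilde\varphi)$ with $\lambda_*\in\mathbb R$ and $\varphi,\tilde\varphi\in L_\infty^+(D\times V)$, where $\varphi>0$ everywhere, $\varphi$ (resp. $\tilde\varphi$) is bounded (resp. a.e. bounded) away from zero on $K\times V$ for each compact $K\subset D$, and such that $\psi_t[\varphi]=e^{\lambda_*t}\varphi$ and $\langle\tilde\varphi,\psi_t[g]\rangle=e^{\lambda_*t}\langle\tilde\varphi,g\rangle$ for all $t\ge0$, $g\in L_\infty^+(D\times V)$, and for some $\varepsilon>0$ $$\sup_{g\in L_\infty^+(D\times V),\ \|g\|_\infty\le1}\big\|e^{-\lambda_*t}\varphi^{-1}\psi_t[g]-\langle\tilde\varphi,g\rangle\big\|_\infty=O(e^{-\varepsilon t}),\qquad t\to\infty .$$ Then the semigroup exists, a leading eigentriple exists, and it is unique up to multiplying $\varphi$ and $\tilde\varphi$ by positive constants (with $\tilde\varphi$ identified up to null sets). Put $\theta=\upsilon_0/(2L\sigma_{\mathtt s})$. Up to such constants, $$\varphi(r,\upsilon)=\phi(r)\mathbf 1_{\{\upsilon=\upsilon_0\}}+\phi(-r)\mathbf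 1_{\{\upsilon=-\upsilon_0\}},\qquad \tilde\varphi(r,\upsilon)=\phi(-r)\mathbf 1_{\{\upsilon=\upsilon_0\}}+\phi(r)\mathbf 1_{\{\upsilon=-\upsilon_0\}},$$ where $\lambda_*$ and $\phi$ are as follows. (i) If $\theta>1$, the equation $\sinh(x)/x=\theta$ has a unique non-negative solution $x_*$, and $$\lambda_*=\sigma_{\mathtt f}-\sigma_{\mathtt s}-\sqrt{\sigma_{\mathtt s}^2+\big(\tfrac{\upsilon_0x_*}{2L}\big)^2},\qquad \phi(r)=\frac{\sinh\big(\frac12x_*(1-\frac rL)\big)}{\sinh(\frac12x_*)} .$$ (ii) If $\theta=1$, then $\lambda_*=\sigma_{\mathtt f}-2\sigma_{\mathtt s}$ and $\phi(r)=1-\frac rL$. (iii) If $\theta<1$, the equation $\sin(x)/x=\theta$ has a smallest non-negative solution $x_*$, and $$\lambda_*=\sigma_{\mathtt f}-\sigma_{\mathtt s}-\operatorname{sgn}(\cos x_*)\sqrt{\sigma_{\mathtt s}^2-\big(\tfrac{\upsilon_0x_*}{2L}\big)^2},\qquad \phi(r)=\frac{\sin\big(\frac12x_*(1-\frac rL)\big)}{\sin(\frac12x_*)}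 .$$ -/

import Mathlib

open Set MeasureTheory

noncomputable section

namespace Slab

/-- The spatial domain `D = (-L, L)`. -/
def dom (L : ℝ) : Set ℝ := Ioo (-L) L

/-- The velocity space `V = {-υ₀, υ₀}`. -/
def vel (υ₀ : ℝ) : Finset ℝ := {-υ₀, υ₀}

/-- Membership in `L_∞^+(D × V)`: the non-negative, uniformly bounded, measurable functions on
`D × V`. A function on `D × V` is represented by a function `g r υ` of two real variables, of which
only the values at `r ∈ D`, `υ ∈ V` matter. -/
structure MemLinftyPlus (L υ₀ : ℝ) (g : ℝ → ℝ → ℝ) : Prop where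
  measurable : ∀ υ ∈ vel υ₀, Measurable (fun r : dom L => g r υ)
  nonneg : ∀ r ∈ dom L, ∀ υ ∈ vel υ₀, 0 ≤ g r υ
  bounded : ∃ C : ℝ, ∀ r ∈ dom L, ∀ υ ∈ vel υ₀, g r υ ≤ C

/-- The pairing `⟨f, g⟩ = ∫_{D × V} f g`, with Lebesgue measure on `D` and counting measure
on `V`. -/
def pairing (L υ₀ : ℝ) (f g : ℝ → ℝ → ℝ) : ℝ :=
  ∑ υ ∈ vel υ₀, ∫ r in dom L, f r υ * g r υ

/-- The exit time `κ = inf {t > 0 : r + υ t ∉ D}` of the straight path from `(r, υ)`. -/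
def exitTime (L r υ : ℝ) : ℝ := sInf {t : ℝ | 0 < t ∧ r + υ * t ∉ dom L}

open Classical in
/-- The advection semigroup `U_t[g](r, υ) = g(r + υ t, υ) 1_{t < κ}`, killed on exit from `D`. -/
def advection (L t : ℝ) (g : ℝ → ℝ → ℝ) (r υ : ℝ) : ℝ :=
  if t < exitTime L r υ then g (r + υ * t) υ else 0

/-- The scattering operator: at rate `σs` the velocity `υ` is replaced by `-υ`. -/
def scattering (σs : ℝ) (f : ℝ → ℝ → ℝ) (r υ : ℝ) : ℝ := σs * (f r (-υ) - f r υ)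

/-- The fission operator: at rate `σf` a neutron is replaced by two neutrons with its velocity. -/
def fission (σf : ℝ) (f : ℝ → ℝ → ℝ) (r υ : ℝ) : ℝ := σf * (2 * f r υ - f r υ)

/-- `u` is the mild solution, started from `g`, of the neutron transport equation:
`u_t = U_t[g] + ∫_0^t U_s[(S + F) u_{t-s}] ds` on `D × V` for all `t ≥ 0`, where `u` is measurable
and is bounded on bounded time intervals. -/
structure IsMildSolution (L υ₀ σs σf : ℝ) (g : ℝ → ℝ → ℝ) (u : ℝ → ℝ → ℝ → ℝ) : Prop where
  measurable : ∀ υ ∈ vel υ₀, Measurable (fun p : Ici (0 : ℝ) × dom L => u p.1 p.2 υ)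
  bounded : ∀ T : ℝ, ∃ C : ℝ, ∀ t ∈ Icc 0 T, ∀ r ∈ dom L, ∀ υ ∈ vel υ₀, |u t r υ| ≤ C
  mild : ∀ t : ℝ, 0 ≤ t → ∀ r ∈ dom L, ∀ υ ∈ vel υ₀,
    u t r υ = advection L t g r υ +
      ∫ s in (0 : ℝ)..t,
        advection L s (fun r' υ' => scattering σs (u (t - s)) r' υ'
          + fission σf (u (t - s)) r' υ') r υ

/-- `ψ t g = ψ_t[g]` is the semigroup on `L_∞^+(D × V)` identified by the mild equation. -/
def IsMildSemigroup (L υ₀ σs σf : ℝ) (ψ : ℝ → (ℝ → ℝ → ℝ) → ℝ → ℝ → ℝ) : Prop :=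
  ∀ g : ℝ → ℝ → ℝ, MemLinftyPlus L υ₀ g → IsMildSolution L υ₀ σs σf g (fun t => ψ t g)

/-- `lam` is the leading eigenvalue, `φ` the right eigenfunction and `φt` the density of the left
eigenmeasure in the Perron-Frobenius asymptotics of the semigroup `ψ`. The last field is
`sup_{g ∈ L_∞^+, ‖g‖ ≤ 1} ‖exp(-lam t) φ⁻¹ ψ_t[g] - ⟨φt, g⟩‖_∞ = O(exp(-ε t))` as `t → ∞`. -/
structure IsLeadEigentriple (L υ₀ : ℝ) (ψ : ℝ → (ℝ → ℝ → ℝ) → ℝ → ℝ → ℝ)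
    (lam : ℝ) (φ φt : ℝ → ℝ → ℝ) : Prop where
  right_mem : MemLinftyPlus L υ₀ φ
  left_mem : MemLinftyPlus L υ₀ φt
  right_pos : ∀ r ∈ dom L, ∀ υ ∈ vel υ₀, 0 < φ r υ
  right_away : ∀ K : Set ℝ, IsCompact K → K ⊆ dom L →
    ∃ c : ℝ, 0 < c ∧ ∀ r ∈ K, ∀ υ ∈ vel υ₀, c ≤ φ r υ
  left_away : ∀ K : Set ℝ, IsCompact K → K ⊆ dom L →
    ∃ c : ℝ, 0 < c ∧ ∀ υ ∈ vel υ₀, ∀ᵐ r ∂(volume.restrict K), c ≤ φt r υ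
  right_eigen : ∀ t : ℝ, 0 ≤ t → ∀ r ∈ dom L, ∀ υ ∈ vel υ₀,
    ψ t φ r υ = Real.exp (lam * t) * φ r υ
  left_eigen : ∀ g : ℝ → ℝ → ℝ, MemLinftyPlus L υ₀ g → ∀ t : ℝ, 0 ≤ t →
    pairing L υ₀ φt (ψ t g) = Real.exp (lam * t) * pairing L υ₀ φt g
  asymptotics : ∃ ε : ℝ, 0 < ε ∧ ∃ C t₀ : ℝ, ∀ t : ℝ, t₀ ≤ t →
    ∀ g : ℝ → ℝ → ℝ, MemLinftyPlus L υ₀ g → (∀ r ∈ dom L, ∀ υ ∈ vel υ₀, g r υ ≤ 1) →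
      ∀ r ∈ dom L, ∀ υ ∈ vel υ₀,
        |Real.exp (-lam * t) * (φ r υ)⁻¹ * ψ t g r υ - pairing L υ₀ φt g| ≤
          C * Real.exp (-ε * t)

/-- The leading eigenvalue is `lam` and the eigenfunctions are `φ`, `φt`, up to positive
multiplicative constants: with `φt` rescaled (the asymptotics force `⟨φt, φ⟩ = 1`) they form a
leading eigentriple, and there is no other one. -/
def LeadEigentripleIs (L υ₀ : ℝ) (ψ : ℝ → (ℝ → ℝ → ℝ) → ℝ → ℝ → ℝ)
    (lam : ℝ) (φ φt : ℝ → ℝ → ℝ) : Prop :=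
  (∃ c : ℝ, 0 < c ∧ IsLeadEigentriple L υ₀ ψ lam φ (fun r υ => c * φt r υ)) ∧
  ∀ (lam' : ℝ) (φ' φt' : ℝ → ℝ → ℝ), IsLeadEigentriple L υ₀ ψ lam' φ' φt' →
    lam' = lam ∧
    (∃ a : ℝ, 0 < a ∧ ∀ r ∈ dom L, ∀ υ ∈ vel υ₀, φ' r υ = a * φ r υ) ∧
    (∃ b : ℝ, 0 < b ∧ ∀ υ ∈ vel υ₀, ∀ᵐ r ∂(volume.restrict (dom L)), φt' r υ = b * φt r υ)

open Classical in
/-- `φ(r, υ) = p(r) 1_{υ = υ₀} + p(-r) 1_{υ = -υ₀}`. -/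
def rightOf (υ₀ : ℝ) (p : ℝ → ℝ) (r υ : ℝ) : ℝ :=
  p r * (if υ = υ₀ then 1 else 0) + p (-r) * (if υ = -υ₀ then 1 else 0)

open Classical in
/-- `φt(r, υ) = p(-r) 1_{υ = υ₀} + p(r) 1_{υ = -υ₀}`. -/
def leftOf (υ₀ : ℝ) (p : ℝ → ℝ) (r υ : ℝ) : ℝ :=
  p (-r) * (if υ = υ₀ then 1 else 0) + p r * (if υ = -υ₀ then 1 else 0)

end Slab

end

/-!
The removal of the potential `σf - σs` by an exponential factor (`IsTrajectory.exp_mul`) reduces the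
mild equation to a transport equation in which particles only change direction, at rate `σs`.
Functions are extended by zero off `D × V`, so that killed advection becomes translation. Solutions
of the reduced equation are called trajectories. They depend linearly on the starting point and are
non-negative when it is (`IsTrajectory.nonneg`), hence are unique; the Dyson series, which sums over
the number of scatterings, gives existence (`exists_isTrajectory`).

*Right eigenfunction.* For `φ(r, ±υ₀) = p(±r)` the eigenvalue equation with eigenvalue `β` reads
`υ₀ p'(r) = β p(r) - σs p(-r)`, with `p(L) = 0` (`IsProfile`). Put `θ = υ₀ / (2Lσs)`. The positive
solutions are `sinh(a(L - r))` if `θ > 1`, `1 - r/L` if `θ = 1` and `sin(a(L - r))` if `θ < 1`; the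
condition on `x = 2aL` is the equation `sinh x / x = θ` or `sin x / x = θ`, and `β` is
`-σs cosh x`, `-σs` or `-σs cos x`.

*Left eigenfunction.* Reversal of paths exchanges the first scattering of each term of the Dyson
series with the last one (`dysonTerm_succ_right`), so the evolution is self-adjoint up to the
reversal of velocities (`IsTrajectory.reciprocity`). Thus the velocity reversal of `φ` is a left
eigenfunction.

*Convergence.* At time `2L/υ₀` every solution that starts below `1` is at most a multiple of the
time to exit, hence of `φ` (`IsTrajectory.le_timeToExit`). Paths with few scatterings give, at a
fixed time and uniformly over `D × V`, a lower bound by the time to exit times the initial mass in a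
fixed set (`IsTrajectory.minorization`). This is Doeblin's condition for the `φ`-transform of the
evolution: it contracts the oscillation of `u / φ` by a factor `q < 1`
(`IsGroundState.exists_contraction`). The limit is identified through the left eigenfunction, whose
pairing with `exp(-β t) u_t` does not depend on `t`.

*Uniqueness.* The asymptotics of `ψ_t[1]` determine the eigenvalue and the right eigenfunction, and
those of `ψ_t[g]`, for indicator functions `g`, determine the left one
(`IsLeadEigentriple.unique`).
-/

namespace Slab

variable {L υ₀ σ α : ℝ} {g : ℝ → ℝ → ℝ} {u w : ℝ → ℝ → ℝ → ℝ}

/-! ### Characteristics and advection -/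

theorem mem_vel {v : ℝ} : v ∈ vel υ₀ ↔ v = -υ₀ ∨ v = υ₀ := by
  simp [vel]

theorem neg_mem_vel {v : ℝ} : -v ∈ vel υ₀ ↔ v ∈ vel υ₀ := by
  simp only [mem_vel, neg_eq_iff_eq_neg, neg_neg]
  tauto

theorem measurableSet_dom : MeasurableSet (dom L) := measurableSet_Ioo

theorem mem_dom_of_mem_of_le {r v s t : ℝ} (hr : r ∈ dom L) (hs : 0 ≤ s) (hst : s ≤ t)
    (ht : r + v * t ∈ dom L) : r + v * s ∈ dom L := by
  simp only [dom, mem_Ioo] at *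
  rcases le_total 0 v with hv | hv
  · have := mul_le_mul_of_nonneg_left hst hv
    have := mul_nonneg hv hs
    constructor <;> linarith
  · have := mul_le_mul_of_nonpos_left hst hv
    have := mul_nonpos_of_nonpos_of_nonneg hv hs
    constructor <;> linarith

theorem lt_exitTime_iff (hυ₀ : 0 < υ₀) {r v s : ℝ} (hr : r ∈ dom L) (hv : v ∈ vel υ₀)
    (hs : 0 ≤ s) : s < exitTime L r v ↔ r + v * s ∈ dom L := by
  have hbdd : BddBelow {t : ℝ | 0 < t ∧ r + v * t ∉ dom L} := ⟨0, fun t ht => ht.1.le⟩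
  constructor
  · intro h
    by_contra hout
    have hs0 : 0 < s := by
      rcases hs.eq_or_lt with h0 | h0
      · subst h0
        simp [hr] at hout
      · exact h0
    exact (csInf_le hbdd (show s ∈ {t : ℝ | 0 < t ∧ r + v * t ∉ dom L} from ⟨hs0, hout⟩)).not_gt h
  · intro h
    simp only [dom, mem_Ioo] at h hr
    obtain ⟨b, hsb, hb⟩ : ∃ b, s < b ∧ ∀ t, 0 < t ∧ r + v * t ∉ dom L ↔ b ≤ t := by
      simp only [dom, mem_Ioo]
      rcases mem_vel.1 hv with rfl | rfl
      · refine ⟨(r + L) / υ₀, by rw [lt_div_iff₀ hυ₀]; linarith, fun t => ?_⟩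
        rw [div_le_iff₀ hυ₀]
        constructor
        · rintro ⟨h0, h1⟩
          by_contra h2
          exact h1 ⟨by linarith, by nlinarith [mul_pos hυ₀ h0]⟩
        · intro h1
          exact ⟨by by_contra h2; nlinarith, fun h2 => by linarith [h2.1]⟩
      · refine ⟨(L - r) / v, by rw [lt_div_iff₀ hυ₀]; linarith, fun t => ?_⟩
        rw [div_le_iff₀ hυ₀]
        constructor
        · rintro ⟨h0, h1⟩
          by_contra h2
          exact h1 ⟨by nlinarith [mul_pos hυ₀ h0], by linarith⟩
        · intro h1
          exact ⟨by by_contra h2; nlinarith, fun h2 => by linarith [h2.2]⟩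
    refine hsb.trans_le (le_csInf ⟨b, (hb b).2 le_rfl⟩ fun t ht => (hb t).1 ht)

theorem advection_eq (hυ₀ : 0 < υ₀) {r v s : ℝ} (hr : r ∈ dom L) (hv : v ∈ vel υ₀)
    (hs : 0 ≤ s) (f : ℝ → ℝ → ℝ) :
    advection L s f r v = (dom L).indicator (fun x => f x v) (r + v * s) := by
  classical
  rw [advection, indicator_apply]
  exact if_congr (lt_exitTime_iff hυ₀ hr hv hs) rfl rfl

open Classical in
/-- The extension by zero to `ℝ × ℝ` of a function on `D × V`. -/
noncomputable def zeroExt (L υ₀ : ℝ) (g : ℝ → ℝ → ℝ) (r v : ℝ) : ℝ :=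
  if r ∈ dom L ∧ v ∈ vel υ₀ then g r v else 0

theorem zeroExt_of_mem {r v : ℝ} (hr : r ∈ dom L) (hv : v ∈ vel υ₀) :
    zeroExt L υ₀ g r v = g r v := if_pos ⟨hr, hv⟩

theorem zeroExt_of_not_mem {r v : ℝ} (h : ¬(r ∈ dom L ∧ v ∈ vel υ₀)) :
    zeroExt L υ₀ g r v = 0 := if_neg h

/-! ### Trajectories -/

/-- A trajectory of the equation `∂ₜ u = v ∂ᵣ u + σ u(·, -v) + α u` on `D × V` with absorbing
boundary, in mild form. It is carried as a function on `ℝ × ℝ × ℝ` that vanishes off `D × V`, so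
that advection is plain translation. Its starting point is `u 0`; its values at negative times play
no role. -/
structure IsTrajectory (L υ₀ σ α : ℝ) (u : ℝ → ℝ → ℝ → ℝ) : Prop where
  supp : ∀ t r v, ¬(r ∈ dom L ∧ v ∈ vel υ₀) → u t r v = 0
  meas : ∀ v, Measurable fun p : ℝ × ℝ => u p.1 p.2 v
  bdd : ∀ T : ℝ, ∃ C : ℝ, ∀ t ∈ Icc 0 T, ∀ r v, |u t r v| ≤ C
  mild : ∀ t, 0 ≤ t → ∀ r ∈ dom L, ∀ v, u t r v = u 0 (r + v * t) v +
    ∫ s in (0 : ℝ)..t, (σ * u (t - s) (r + v * s) (-v) + α * u (t - s) (r + v * s) v)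

namespace IsTrajectory

theorem intervalIntegrable_char (hu : IsTrajectory L υ₀ σ α u) {t : ℝ} (r v : ℝ) {a b : ℝ}
    (ha : a ∈ Icc 0 t) (hb : b ∈ Icc 0 t) :
    IntervalIntegrable
      (fun s => σ * u (t - s) (r + v * s) (-v) + α * u (t - s) (r + v * s) v) volume a b := by
  obtain ⟨C, hC⟩ := hu.bdd t
  have hm : ∀ v', Measurable fun s => u (t - s) (r + v * s) v' := fun v' =>
    (hu.meas v').comp (f := fun s => (t - s, r + v * s)) (by fun_prop)
  refine IntervalIntegrable.mono_fun' (g := fun _ => |σ| * C + |α| * C)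
    intervalIntegrable_const
    (((hm (-v)).const_mul σ).add ((hm v).const_mul α)).aestronglyMeasurable ?_
  refine (ae_restrict_iff' measurableSet_uIoc).2 (Filter.Eventually.of_forall fun s hs => ?_)
  have hs' : s ∈ Icc 0 t := uIcc_subset_Icc ha hb (uIoc_subset_uIcc hs)
  have h : t - s ∈ Icc 0 t := ⟨by linarith [hs'.2], by linarith [hs'.1]⟩
  simp only [Real.norm_eq_abs]
  refine (abs_add_le _ _).trans ?_
  rw [abs_mul, abs_mul]
  gcongr <;> exact hC _ h _ _

/-- The mild equation along the whole characteristic through `(r, v)`: after the exit from `D` both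
sides vanish. -/
theorem char_eq (hu : IsTrajectory L υ₀ σ α u) {t s r : ℝ} (v : ℝ) (hs : 0 ≤ s) (hst : s ≤ t)
    (hr : r ∈ dom L) :
    u (t - s) (r + v * s) v = u 0 (r + v * t) v +
      ∫ τ in s..t, (σ * u (t - τ) (r + v * τ) (-v) + α * u (t - τ) (r + v * τ) v) := by
  by_cases hin : r + v * s ∈ dom L
  · rw [hu.mild (t - s) (by linarith) _ hin v]
    have h := intervalIntegral.integral_comp_add_right (a := 0) (b := t - s)
      (fun τ => σ * u (t - τ) (r + v * τ) (-v) + α * u (t - τ) (r + v * τ) v) s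
    simp only [zero_add, sub_add_cancel] at h
    rw [← h]
    congr 1
    · congr 1; ring
    · refine intervalIntegral.integral_congr fun τ _ => ?_
      have h1 : t - s - τ = t - (τ + s) := by ring
      have h2 : r + v * s + v * τ = r + v * (τ + s) := by ring
      simp only [h1, h2]
  · have hout : ∀ τ, s ≤ τ → r + v * τ ∉ dom L := fun τ hτ h =>
      hin (mem_dom_of_mem_of_le hr hs hτ h)
    rw [hu.supp _ _ _ fun h => hin h.1, hu.supp _ _ _ fun h => hout t hst h.1, zero_add]
    symm
    refine (intervalIntegral.integral_congr (g := fun _ => 0) fun τ hτ => ?_).trans (by simp)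
    rw [uIcc_of_le hst] at hτ
    have := hout τ hτ.1
    simp only [hu.supp _ _ _ fun h => this h.1, mul_zero, add_zero]

theorem shift (hu : IsTrajectory L υ₀ σ α u) {a : ℝ} (ha : 0 ≤ a) :
    IsTrajectory L υ₀ σ α (fun t => u (a + t)) where
  supp t r v h := hu.supp _ _ _ h
  meas v := (hu.meas v).comp (f := fun p : ℝ × ℝ => (a + p.1, p.2)) (by fun_prop)
  bdd T := by
    obtain ⟨C, hC⟩ := hu.bdd (a + T)
    exact ⟨C, fun t ht r v => hC _ ⟨by linarith [ht.1], by linarith [ht.2]⟩ r v⟩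
  mild t ht r hr v := by
    have h0 := hu.char_eq v le_rfl (by linarith : 0 ≤ a + t) hr
    have h1 := hu.char_eq v ht (by linarith : t ≤ a + t) hr
    have hadd := intervalIntegral.integral_add_adjacent_intervals
      (hu.intervalIntegrable_char r v (t := a + t) (a := 0) (b := t) ⟨le_rfl, by linarith⟩
        ⟨ht, by linarith⟩)
      (hu.intervalIntegrable_char r v (t := a + t) (a := t) (b := a + t) ⟨ht, by linarith⟩
        ⟨by linarith, le_rfl⟩)
    rw [← hadd] at h0
    simp only [sub_zero, mul_zero, add_zero, add_sub_cancel_right] at h0 h1 ⊢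
    rw [h0, h1]
    have h2 : ∀ s, a + (t - s) = a + t - s := fun s => by ring
    simp only [h2]
    ring

theorem sub_smul (hu : IsTrajectory L υ₀ σ α u) (hw : IsTrajectory L υ₀ σ α w) (a b : ℝ) :
    IsTrajectory L υ₀ σ α (fun t r v => a * u t r v - b * w t r v) where
  supp t r v h := by simp only [hu.supp _ _ _ h, hw.supp _ _ _ h, mul_zero, sub_zero]
  meas v := ((hu.meas v).const_mul a).sub ((hw.meas v).const_mul b)
  bdd T := by
    obtain ⟨C, hC⟩ := hu.bdd T
    obtain ⟨C', hC'⟩ := hw.bdd T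
    refine ⟨|a| * C + |b| * C', fun t ht r v => (abs_sub _ _).trans ?_⟩
    rw [abs_mul, abs_mul]
    gcongr
    · exact hC t ht r v
    · exact hC' t ht r v
  mild t ht r hr v := by
    have iu := hu.intervalIntegrable_char r v (t := t) (a := 0) (b := t) ⟨le_rfl, ht⟩ ⟨ht, le_rfl⟩
    have iw := hw.intervalIntegrable_char r v (t := t) (a := 0) (b := t) ⟨le_rfl, ht⟩ ⟨ht, le_rfl⟩
    rw [hu.mild t ht r hr v, hw.mild t ht r hr v]
    have : ∀ A B I J : ℝ, a * (A + I) - b * (B + J) = a * A - b * B + (a * I - b * J) :=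
      fun A B I J => by ring
    rw [this, ← intervalIntegral.integral_const_mul, ← intervalIntegral.integral_const_mul,
      ← intervalIntegral.integral_sub (iu.const_mul a) (iw.const_mul b)]
    congr 1
    refine intervalIntegral.integral_congr fun s _ => ?_
    ring

/-- Multiplication by `exp (β t)` shifts the potential by `β`. Along a characteristic `u` is
absolutely continuous, and this is integration by parts against the exponential. -/
theorem exp_mul (hu : IsTrajectory L υ₀ σ α u) (β : ℝ) :
    IsTrajectory L υ₀ σ (α + β) (fun t r v => Real.exp (β * t) * u t r v) where
  supp t r v h := by simp only [hu.supp _ _ _ h, mul_zero]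
  meas v := Measurable.mul (by fun_prop) (hu.meas v)
  bdd T := by
    obtain ⟨C, hC⟩ := hu.bdd T
    refine ⟨Real.exp (|β| * T) * C, fun t ht r v => ?_⟩
    rw [abs_mul, Real.abs_exp]
    have : β * t ≤ |β| * T :=
      (mul_le_mul_of_nonneg_right (le_abs_self β) ht.1).trans
        (mul_le_mul_of_nonneg_left ht.2 (abs_nonneg β))
    gcongr
    exact hC t ht r v
  mild t ht r hr v := by
    set k : ℝ → ℝ := fun τ =>
      σ * u (t - τ) (r + v * τ) (-v) + α * u (t - τ) (r + v * τ) v with hk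
    have ik : ∀ {a b}, a ∈ Icc 0 t → b ∈ Icc 0 t → IntervalIntegrable k volume a b :=
      fun ha hb => hu.intervalIntegrable_char r v ha hb
    have h0 : (0 : ℝ) ∈ Icc 0 t := ⟨le_rfl, ht⟩
    have ht' : t ∈ Icc 0 t := ⟨ht, le_rfl⟩
    -- `-y` is an antiderivative of `k` on `[0, t]`, where `y s = u (t - s) (r + v * s) v`
    set K : ℝ → ℝ := fun s => ∫ τ in (0 : ℝ)..s, k τ with hK
    have hy : ∀ s ∈ Icc 0 t,
        u (t - s) (r + v * s) v = u 0 (r + v * t) v + K t - K s := by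
      intro s hs
      rw [hu.char_eq v hs.1 hs.2 hr]
      have := intervalIntegral.integral_add_adjacent_intervals (ik h0 hs) (ik hs ht')
      simp only [hK]
      linarith
    have hKac : AbsolutelyContinuousOnInterval K 0 t :=
      (ik h0 ht').absolutelyContinuousOnInterval_intervalIntegral (by simp)
    set e : ℝ → ℝ := fun s => Real.exp (β * (t - s)) with he
    have hed : ∀ s, HasDerivAt e (-β * e s) s := fun s => by
      have := (((hasDerivAt_id' s).const_sub t).const_mul β).exp
      refine this.congr_deriv ?_
      simp only [he]; ring
    have heac : AbsolutelyContinuousOnInterval e 0 t := by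
      refine ContDiffOn.absolutelyContinuousOnInterval ?_
      exact (Real.contDiff_exp.comp (by fun_prop)).contDiffOn
    have hibp := heac.integral_mul_deriv_eq_deriv_mul hKac
    have hderiv : ∫ s in (0 : ℝ)..t, e s * deriv K s = ∫ s in (0 : ℝ)..t, e s * k s := by
      refine intervalIntegral.integral_congr_ae ?_
      filter_upwards [(ik h0 ht').ae_hasDerivAt_integral] with s hs hs'
      rw [(hs (uIoc_subset_uIcc hs') 0 (by simp)).deriv]
    have ie : ∀ c : ℝ, IntervalIntegrable (fun s => c * e s) volume 0 t := fun c =>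
      (by fun_prop : Continuous fun s => c * e s).intervalIntegrable _ _
    have ieK : IntervalIntegrable (fun s => β * e s * K s) volume 0 t := by
      refine ContinuousOn.intervalIntegrable ?_
      exact (by fun_prop : Continuous fun s => β * e s).continuousOn.mul hKac.continuousOn
    have iek : IntervalIntegrable (fun s => e s * k s) volume 0 t :=
      (ik h0 ht').continuousOn_mul (by fun_prop : Continuous e).continuousOn
    have hE : ∫ s in (0 : ℝ)..t, β * e s = e 0 - e t := by
      have := intervalIntegral.integral_eq_sub_of_hasDerivAt (a := 0) (b := t)
        (fun s _ => hed s) (ie (-β))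
      simp only [neg_mul, intervalIntegral.integral_neg] at this
      linarith
    have hde : ∀ s, deriv e s = -β * e s := fun s => (hed s).deriv
    simp only [hde] at hibp
    have hgoal : ∫ s in (0 : ℝ)..t, (σ * (Real.exp (β * (t - s)) * u (t - s) (r + v * s) (-v)) +
        (α + β) * (Real.exp (β * (t - s)) * u (t - s) (r + v * s) v)) =
        ∫ s in (0 : ℝ)..t, (e s * k s + ((u 0 (r + v * t) v + K t) * (β * e s)
          - β * e s * K s)) := by
      refine intervalIntegral.integral_congr fun s hs => ?_
      rw [uIcc_of_le ht] at hs
      have := hy s hs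
      simp only [hk, he]
      rw [this]; ring
    have hKt : u t r v = u 0 (r + v * t) v + K t := by
      have := hy 0 h0
      simpa [hK] using this
    have hneg : ∫ s in (0 : ℝ)..t, -β * e s * K s = -∫ s in (0 : ℝ)..t, β * e s * K s := by
      rw [← intervalIntegral.integral_neg]
      refine intervalIntegral.integral_congr fun s _ => ?_
      ring
    rw [hgoal, intervalIntegral.integral_add iek (((ie β).const_mul _).sub ieK),
      intervalIntegral.integral_sub ((ie β).const_mul _) ieK, intervalIntegral.integral_const_mul,
      hE, ← hderiv, hibp, hneg, hKt]
    have hK0 : K 0 = 0 := by simp [hK]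
    have het : e t = 1 := by simp [he]
    have he0 : e 0 = Real.exp (β * t) := by simp [he]
    rw [hK0, het, he0]
    simp only [mul_zero, Real.exp_zero]
    ring

/-- Positivity. If `-C * exp (2σt)` is a lower bound, then the mild equation improves it by the
factor `1/2`. -/
theorem nonneg (hσ : 0 < σ) (hu : IsTrajectory L υ₀ σ 0 u) (h0 : ∀ r v, 0 ≤ u 0 r v) {t : ℝ}
    (ht : 0 ≤ t) (r v : ℝ) : 0 ≤ u t r v := by
  obtain ⟨C, hC⟩ := hu.bdd t
  have hC0 : 0 ≤ C := (abs_nonneg _).trans (hC 0 ⟨le_rfl, ht⟩ 0 0)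
  have key : ∀ n : ℕ, ∀ s ∈ Icc 0 t, ∀ r v, -(C * (1 / 2) ^ n * Real.exp (2 * σ * s)) ≤ u s r v := by
    intro n
    induction n with
    | zero =>
      intro s hs r v
      have h1 := (abs_le.1 (hC s hs r v)).1
      have h2 : 1 ≤ Real.exp (2 * σ * s) := Real.one_le_exp (by have := hs.1; positivity)
      nlinarith
    | succ n ih =>
      intro s hs r v
      by_cases hr : r ∈ dom L
      · rw [hu.mild s hs.1 r hr v]
        have hint : ∫ τ in (0 : ℝ)..s, -σ * (C * (1 / 2) ^ n) * Real.exp (2 * σ * (s - τ)) =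
            -(C * (1 / 2) ^ (n + 1)) * (Real.exp (2 * σ * s) - 1) := by
          have hd : ∀ τ, HasDerivAt
              (fun τ => C * (1 / 2) ^ (n + 1) * Real.exp (2 * σ * (s - τ)))
              (-σ * (C * (1 / 2) ^ n) * Real.exp (2 * σ * (s - τ))) τ := fun τ => by
            have := ((((hasDerivAt_id' τ).const_sub s).const_mul (2 * σ)).exp).const_mul
              (C * (1 / 2) ^ (n + 1))
            refine this.congr_deriv ?_
            rw [pow_succ]; ring
          rw [intervalIntegral.integral_eq_sub_of_hasDerivAt (fun τ _ => hd τ)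
            ((by fun_prop : Continuous fun τ =>
              -σ * (C * (1 / 2) ^ n) * Real.exp (2 * σ * (s - τ))).intervalIntegrable _ _)]
          simp only [sub_self, mul_zero, Real.exp_zero, sub_zero]
          ring
        have hle : ∫ τ in (0 : ℝ)..s, -σ * (C * (1 / 2) ^ n) * Real.exp (2 * σ * (s - τ)) ≤
            ∫ τ in (0 : ℝ)..s,
              (σ * u (s - τ) (r + v * τ) (-v) + 0 * u (s - τ) (r + v * τ) v) := by
          refine intervalIntegral.integral_mono_on hs.1
            ((by fun_prop : Continuous fun τ =>
              -σ * (C * (1 / 2) ^ n) * Real.exp (2 * σ * (s - τ))).intervalIntegrable _ _)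
            (hu.intervalIntegrable_char r v ⟨le_rfl, hs.1⟩ ⟨hs.1, le_rfl⟩) fun τ hτ => ?_
          have := mul_le_mul_of_nonneg_left
            (ih (s - τ) ⟨by linarith [hτ.2], by linarith [hτ.1, hs.2]⟩ (r + v * τ) (-v)) hσ.le
          linarith
        have := h0 (r + v * s) v
        have : 0 ≤ C * (1 / 2) ^ (n + 1) := by positivity
        linarith
      · rw [hu.supp _ _ _ fun h => hr h.1]
        have : 0 ≤ C * (1 / 2) ^ (n + 1) * Real.exp (2 * σ * s) := by positivity
        linarith
  have hlim : Filter.Tendsto (fun n : ℕ => -(C * (1 / 2) ^ n * Real.exp (2 * σ * t)))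
      Filter.atTop (nhds (-(C * 0 * Real.exp (2 * σ * t)))) :=
    (((tendsto_pow_atTop_nhds_zero_of_lt_one (by norm_num) (by norm_num)).const_mul C).mul_const
      _).neg
  rw [mul_zero, zero_mul, neg_zero] at hlim
  exact le_of_tendsto' hlim fun n => key n t ⟨ht, le_rfl⟩ r v

/-- Positivity of both differences gives equality. -/
theorem unique (hσ : 0 < σ) (hu : IsTrajectory L υ₀ σ 0 u) (hw : IsTrajectory L υ₀ σ 0 w)
    (h0 : ∀ r v, u 0 r v = w 0 r v) {t : ℝ} (ht : 0 ≤ t) (r v : ℝ) : u t r v = w t r v := by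
  have h1 := (hu.sub_smul hw 1 1).nonneg hσ (fun r v => by simp [h0]) ht r v
  have h2 := (hw.sub_smul hu 1 1).nonneg hσ (fun r v => by simp [h0]) ht r v
  linarith

end IsTrajectory

/-! ### Mild solutions as trajectories -/

open Classical in
/-- The function `exp (-γ t) u`, extended by zero off `D × V` and to negative times. For a mild
solution `u` of the neutron transport equation and `γ = σf - σs` it is a trajectory without
potential. -/
noncomputable def gauged (L υ₀ γ : ℝ) (u : ℝ → ℝ → ℝ → ℝ) (t r v : ℝ) : ℝ :=
  if 0 ≤ t then Real.exp (-γ * t) * zeroExt L υ₀ (u t) r v else 0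

theorem measurable_zeroExt_of_subtype {v : ℝ} (hv : v ∈ vel υ₀)
    (hu : Measurable (fun p : Ici (0 : ℝ) × dom L => u p.1 p.2 v)) :
    Measurable fun p : ℝ × ℝ => if 0 ≤ p.1 then zeroExt L υ₀ (u p.1) p.2 v else 0 := by
  classical
  have hS : MeasurableSet ((Ici (0 : ℝ)) ×ˢ dom L) := measurableSet_Ici.prod measurableSet_dom
  have h : Measurable fun p : ℝ × ℝ =>
      if hp : p ∈ (Ici (0 : ℝ)) ×ˢ dom L then u p.1 p.2 v else 0 := by
    refine Measurable.dite (f := fun p : ((Ici (0 : ℝ)) ×ˢ dom L : Set (ℝ × ℝ)) => u p.1.1 p.1.2 v)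
      (g := fun _ => 0) ?_ measurable_const hS
    exact hu.comp (f := fun p : ((Ici (0 : ℝ)) ×ˢ dom L : Set (ℝ × ℝ)) =>
      ((⟨p.1.1, p.2.1⟩, ⟨p.1.2, p.2.2⟩) : Ici (0 : ℝ) × dom L)) (by fun_prop)
  convert h using 2 with p
  by_cases h1 : 0 ≤ p.1 <;> by_cases h2 : p.2 ∈ dom L <;> simp [zeroExt, h1, h2, hv]

theorem IsMildSolution.isTrajectory {σs σf : ℝ} (hυ₀ : 0 < υ₀)
    (hu : IsMildSolution L υ₀ σs σf g u) :
    IsTrajectory L υ₀ σs (σf - σs)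
      (fun t r v => if 0 ≤ t then zeroExt L υ₀ (u t) r v else 0) where
  supp t r v h := by simp [zeroExt_of_not_mem h]
  meas v := by
    by_cases hv : v ∈ vel υ₀
    · exact measurable_zeroExt_of_subtype hv (hu.measurable v hv)
    · simp only [zeroExt_of_not_mem fun h => hv h.2, ite_self]
      exact measurable_const
  bdd T := by
    obtain ⟨C, hC⟩ := hu.bounded T
    refine ⟨|C|, fun t ht r v => ?_⟩
    by_cases h : r ∈ dom L ∧ v ∈ vel υ₀
    · simp only [ht.1, if_true, zeroExt_of_mem h.1 h.2]
      exact (hC t ht r h.1 v h.2).trans (le_abs_self C)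
    · simp [zeroExt_of_not_mem h]
  mild t ht r hr v := by
    by_cases hv : v ∈ vel υ₀
    · have hg : ∀ x ∈ dom L, u 0 x v = g x v := fun x hx => by
        rw [hu.mild 0 le_rfl x hx v hv, advection_eq hυ₀ hx hv le_rfl]
        simp [hx]
      simp only [ht, le_refl, if_true]
      rw [zeroExt_of_mem hr hv, hu.mild t ht r hr v hv, advection_eq hυ₀ hr hv ht]
      congr 1
      · by_cases h : r + v * t ∈ dom L
        · rw [indicator_of_mem h, zeroExt_of_mem h hv, hg _ h]
        · rw [indicator_of_notMem h, zeroExt_of_not_mem fun h' => h h'.1]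
      · refine intervalIntegral.integral_congr fun s hs => ?_
        rw [uIcc_of_le ht] at hs
        have hts : 0 ≤ t - s := by linarith [hs.2]
        simp only [hts, if_true]
        rw [advection_eq hυ₀ hr hv hs.1]
        by_cases h : r + v * s ∈ dom L
        · rw [indicator_of_mem h, zeroExt_of_mem h hv, zeroExt_of_mem h (neg_mem_vel.2 hv),
            scattering, fission]
          ring
        · rw [indicator_of_notMem h, zeroExt_of_not_mem fun h' => h h'.1,
            zeroExt_of_not_mem fun h' => h h'.1]
          ring
    · simp [zeroExt_of_not_mem fun h : _ ∧ _ => hv h.2,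
        zeroExt_of_not_mem fun h : _ ∧ _ => hv (neg_mem_vel.1 h.2)]

theorem IsMildSolution.isTrajectory_gauged {σs σf : ℝ} (hυ₀ : 0 < υ₀)
    (hu : IsMildSolution L υ₀ σs σf g u) :
    IsTrajectory L υ₀ σs 0 (gauged L υ₀ (σf - σs) u) := by
  have h := (hu.isTrajectory hυ₀).exp_mul (-(σf - σs))
  rw [add_neg_cancel] at h
  convert h using 1
  funext t r v
  simp only [gauged, mul_ite, mul_zero]

theorem IsMildSolution.gauged_zero {σs σf : ℝ} (hυ₀ : 0 < υ₀)
    (hu : IsMildSolution L υ₀ σs σf g u) (r v : ℝ) :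
    gauged L υ₀ (σf - σs) u 0 r v = zeroExt L υ₀ g r v := by
  by_cases h : r ∈ dom L ∧ v ∈ vel υ₀
  · simp only [gauged, le_refl, if_true, mul_zero, Real.exp_zero, one_mul,
      zeroExt_of_mem h.1 h.2]
    rw [hu.mild 0 le_rfl r h.1 v h.2, advection_eq hυ₀ h.1 h.2 le_rfl]
    simp [h.1]
  · simp [gauged, zeroExt_of_not_mem h]

/-- The converse of `IsMildSolution.isTrajectory_gauged`. -/
theorem IsTrajectory.isMildSolution {σs σf : ℝ} (hυ₀ : 0 < υ₀) (hu : IsTrajectory L υ₀ σs 0 u)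
    (h0 : ∀ r ∈ dom L, ∀ v ∈ vel υ₀, u 0 r v = g r v) :
    IsMildSolution L υ₀ σs σf g (fun t r v => Real.exp ((σf - σs) * t) * u t r v) := by
  have h := hu.exp_mul (σf - σs)
  rw [zero_add] at h
  refine ⟨fun v _ => ?_, fun T => ?_, fun t ht r hr v hv => ?_⟩
  · exact (h.meas v).comp (f := fun p : Ici (0 : ℝ) × dom L => ((p.1 : ℝ), (p.2 : ℝ)))
      (by fun_prop)
  · obtain ⟨C, hC⟩ := h.bdd T
    exact ⟨C, fun t ht r _ v _ => hC t ht r v⟩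
  · rw [h.mild t ht r hr v, advection_eq hυ₀ hr hv ht]
    congr 1
    · by_cases hx : r + v * t ∈ dom L
      · rw [indicator_of_mem hx, h0 _ hx v hv]
        simp
      · rw [indicator_of_notMem hx, hu.supp _ _ _ fun h' => hx h'.1, mul_zero]
    · refine intervalIntegral.integral_congr fun s hs => ?_
      rw [uIcc_of_le ht] at hs
      rw [advection_eq hυ₀ hr hv hs.1]
      by_cases hx : r + v * s ∈ dom L
      · rw [indicator_of_mem hx, scattering, fission]
        ring
      · rw [indicator_of_notMem hx, hu.supp _ _ _ fun h' => hx h'.1,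
          hu.supp _ _ _ fun h' => hx h'.1]
        ring

end Slab

namespace Slab

variable {L υ₀ σ : ℝ} {c : NNReal} {u w : ℝ → ℝ → ℝ → ℝ}

/-! ### The Dyson series -/

/-- Advection by time `t`, killed off `D`, of a `[0, ∞]`-valued function that vanishes off `D`. -/
noncomputable def eadvection (L t : ℝ) (f : ℝ → ℝ → ENNReal) (r v : ℝ) : ENNReal :=
  (dom L).indicator (fun r => f (r + v * t) v) r

/-- Scattering gain at rate `c`. -/
noncomputable def ecollision (c : NNReal) (f : ℝ → ℝ → ENNReal) (r v : ℝ) : ENNReal :=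
  c * f r (-v)

/-- Velocity reversal. -/
def reverse (f : ℝ → ℝ → ENNReal) (r v : ℝ) : ENNReal := f r (-v)

/-- The contribution to the solution at time `t` of the paths with exactly `n` scatterings. -/
noncomputable def dysonTerm (L : ℝ) (c : NNReal) : ℕ → ℝ → (ℝ → ℝ → ENNReal) → ℝ → ℝ → ENNReal
  | 0, t, f => eadvection L t f
  | n + 1, t, f => fun r v =>
      ∫⁻ s in Ioo 0 t, eadvection L s (ecollision c (dysonTerm L c n (t - s) f)) r v

/-- The Dyson series, which sums over the number of scatterings. -/
noncomputable def dysonSeries (L : ℝ) (c : NNReal) (t : ℝ) (f : ℝ → ℝ → ENNReal) (r v : ℝ) :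
    ENNReal :=
  ∑' n, dysonTerm L c n t f r v

theorem reverse_reverse (f : ℝ → ℝ → ENNReal) : reverse (reverse f) = f := by
  funext r v
  simp [reverse]

theorem setLIntegral_Ioo_reflect (t : ℝ) (G : ℝ → ENNReal) :
    ∫⁻ s in Ioo 0 t, G (t - s) = ∫⁻ s in Ioo 0 t, G s := by
  rw [← lintegral_indicator measurableSet_Ioo, ← lintegral_indicator measurableSet_Ioo,
    ← lintegral_sub_left_eq_self _ t]
  refine lintegral_congr fun s => ?_
  simp only [indicator_apply, mem_Ioo, sub_sub_cancel]
  refine if_congr ⟨fun h => ⟨?_, ?_⟩, fun h => ⟨?_, ?_⟩⟩ rfl rfl <;> linarith [h.1, h.2]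

theorem lintegral_triangle_swap {F : ℝ → ℝ → ENNReal} (hF : Measurable (Function.uncurry F))
    (t : ℝ) :
    ∫⁻ s in Ioo 0 t, ∫⁻ τ in Ioo 0 (t - s), F s τ =
      ∫⁻ τ in Ioo 0 t, ∫⁻ s in Ioo 0 (t - τ), F s τ := by
  let T : Set (ℝ × ℝ) := {p | 0 < p.1} ∩ ({p | 0 < p.2} ∩ {p | p.1 + p.2 < t})
  have hT : MeasurableSet T :=
    (measurableSet_lt (by fun_prop) (by fun_prop)).inter
      ((measurableSet_lt (by fun_prop) (by fun_prop)).inter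
        (measurableSet_lt (by fun_prop) (by fun_prop)))
  have h1 : ∫⁻ s in Ioo 0 t, ∫⁻ τ in Ioo 0 (t - s), F s τ =
      ∫⁻ s, ∫⁻ τ, T.indicator (Function.uncurry F) (s, τ) := by
    rw [← lintegral_indicator measurableSet_Ioo]
    refine lintegral_congr fun s => ?_
    by_cases hs : s ∈ Ioo 0 t
    · rw [indicator_of_mem hs, ← lintegral_indicator measurableSet_Ioo]
      refine lintegral_congr fun τ => ?_
      simp only [indicator_apply, mem_Ioo, T, mem_inter_iff, mem_ofPred_eq, Function.uncurry]
      exact if_congr ⟨fun h => ⟨hs.1, h.1, by linarith [h.2]⟩, fun h => ⟨h.2.1, by linarith⟩⟩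
        rfl rfl
    · rw [indicator_of_notMem hs]
      refine ((lintegral_congr fun τ => ?_).trans lintegral_zero).symm
      refine indicator_of_notMem (fun h => hs ⟨h.1, ?_⟩) _
      have h3 : 0 < τ := h.2.1
      have h4 : s + τ < t := h.2.2
      linarith
  have h2 : ∫⁻ τ in Ioo 0 t, ∫⁻ s in Ioo 0 (t - τ), F s τ =
      ∫⁻ τ, ∫⁻ s, T.indicator (Function.uncurry F) (s, τ) := by
    rw [← lintegral_indicator measurableSet_Ioo]
    refine lintegral_congr fun τ => ?_
    by_cases hs : τ ∈ Ioo 0 t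
    · rw [indicator_of_mem hs, ← lintegral_indicator measurableSet_Ioo]
      refine lintegral_congr fun s => ?_
      simp only [indicator_apply, mem_Ioo, T, mem_inter_iff, mem_ofPred_eq, Function.uncurry]
      exact if_congr ⟨fun h => ⟨h.1, hs.1, by linarith [h.2]⟩, fun h => ⟨h.1, by linarith⟩⟩
        rfl rfl
    · rw [indicator_of_notMem hs]
      refine ((lintegral_congr fun s => ?_).trans lintegral_zero).symm
      refine indicator_of_notMem (fun h => hs ⟨h.2.1, ?_⟩) _
      have h3 : 0 < s := h.1
      have h4 : s + τ < t := h.2.2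
      linarith
  rw [h1, h2]
  exact lintegral_lintegral_swap
    (f := fun s τ => T.indicator (Function.uncurry F) (s, τ)) (hF.indicator hT).aemeasurable

theorem eadvection_ecollision {r : ℝ} (v s : ℝ) (h : ℝ → ℝ → ENNReal) (hr : r ∈ dom L) :
    eadvection L s (ecollision c h) r v = c * h (r + v * s) (-v) := by
  rw [eadvection, indicator_of_mem hr, ecollision]

theorem eadvection_ecollision_lintegral (A : Set ℝ) (h : ℝ → ℝ → ℝ → ENNReal) (s r v : ℝ) :
    eadvection L s (ecollision c fun r v => ∫⁻ τ in A, h τ r v) r v =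
      ∫⁻ τ in A, eadvection L s (ecollision c (h τ)) r v := by
  by_cases hr : r ∈ dom L
  · simp only [eadvection_ecollision _ _ _ hr]
    rw [lintegral_const_mul' _ _ ENNReal.coe_ne_top]
  · simp [eadvection, hr]

theorem measurable_eadvection {A : Type*} [MeasurableSpace A] {f : A → ℝ → ℝ → ENNReal}
    (hf : ∀ v, Measurable fun p : A × ℝ => f p.1 p.2 v) {t ρ : A → ℝ}
    (ht : Measurable t) (hρ : Measurable ρ) (v : ℝ) :
    Measurable fun a => eadvection L (t a) (f a) (ρ a) v := by
  have h : Measurable fun a => f a (ρ a + v * t a) v :=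
    (hf v).comp (f := fun a => (a, ρ a + v * t a)) (by fun_prop)
  exact h.indicator (hρ measurableSet_dom)

/-- Joint measurability in time, position and an auxiliary parameter of the initial function. -/
theorem measurable_dysonTerm {A : Type*} [MeasurableSpace A] {f : A → ℝ → ℝ → ENNReal}
    (hf : ∀ v, Measurable fun p : A × ℝ => f p.1 p.2 v) (n : ℕ) (v : ℝ) :
    Measurable fun p : (A × ℝ) × ℝ => dysonTerm L c n p.1.2 (f p.1.1) p.2 v := by
  induction n generalizing v with
  | zero =>
    exact measurable_eadvection (f := fun p : (A × ℝ) × ℝ => f p.1.1) (t := fun p => p.1.2)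
      (ρ := fun p => p.2)
      (fun v => (hf v).comp (f := fun q : ((A × ℝ) × ℝ) × ℝ => (q.1.1.1, q.2)) (by fun_prop))
      (by fun_prop) (by fun_prop) v
  | succ n ih =>
    have h1 : Measurable fun q : ((A × ℝ) × ℝ) × ℝ =>
        (Ioo 0 q.1.1.2).indicator (fun s => eadvection L s
          (ecollision c (dysonTerm L c n (q.1.1.2 - s) (f q.1.1.1))) q.1.2 v) q.2 := by
      have h2 : Measurable fun q : ((A × ℝ) × ℝ) × ℝ => eadvection L q.2
          (ecollision c (dysonTerm L c n (q.1.1.2 - q.2) (f q.1.1.1))) q.1.2 v := by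
        refine measurable_eadvection
          (f := fun q : ((A × ℝ) × ℝ) × ℝ =>
            ecollision c (dysonTerm L c n (q.1.1.2 - q.2) (f q.1.1.1)))
          (t := fun q => q.2) (ρ := fun q => q.1.2) (fun v' => ?_) (by fun_prop) (by fun_prop) v
        refine Measurable.const_mul ?_ _
        exact (ih (-v')).comp (f := fun z : (((A × ℝ) × ℝ) × ℝ) × ℝ =>
          ((z.1.1.1.1, z.1.1.1.2 - z.1.2), z.2)) (by fun_prop)
      have hS : MeasurableSet
          ({q : ((A × ℝ) × ℝ) × ℝ | 0 < q.2} ∩ {q : ((A × ℝ) × ℝ) × ℝ | q.2 < q.1.1.2}) :=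
        (measurableSet_lt (by fun_prop) (by fun_prop)).inter
          (measurableSet_lt (by fun_prop) (by fun_prop))
      exact h2.indicator hS
    have h3 := h1.lintegral_prod_right' (ν := volume)
    simp only [lintegral_indicator measurableSet_Ioo] at h3
    exact h3

theorem measurable_dysonTerm' {f : ℝ → ℝ → ENNReal} (hf : ∀ v, Measurable fun r => f r v)
    (n : ℕ) (v : ℝ) : Measurable fun p : ℝ × ℝ => dysonTerm L c n p.1 f p.2 v :=
  (measurable_dysonTerm (A := Unit) (f := fun _ => f)
    (fun v => (hf v).comp measurable_snd) n v).comp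
    (f := fun p : ℝ × ℝ => (((), p.1), p.2)) (by fun_prop)

theorem dysonTerm_eq_zero {f : ℝ → ℝ → ENNReal}
    (hf : ∀ r v, ¬(r ∈ dom L ∧ v ∈ vel υ₀) → f r v = 0) (n : ℕ) (t : ℝ) {r v : ℝ}
    (h : ¬(r ∈ dom L ∧ v ∈ vel υ₀)) : dysonTerm L c n t f r v = 0 := by
  by_cases hr : r ∈ dom L
  · have hv : v ∉ vel υ₀ := fun hv => h ⟨hr, hv⟩
    clear h
    induction n generalizing r v t with
    | zero => simp [dysonTerm, eadvection, hr, hf _ v fun h => hv h.2]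
    | succ n ih =>
      simp only [dysonTerm]
      refine (lintegral_congr fun s => ?_).trans lintegral_zero
      rw [eadvection_ecollision _ _ _ hr]
      by_cases hx : r + v * s ∈ dom L
      · rw [ih _ hx fun h' => hv (neg_mem_vel.1 h'), mul_zero]
      · cases n <;> simp [dysonTerm, eadvection, hx]
  · cases n <;> simp [dysonTerm, eadvection, hr]

/-- The first scattering and the last one may be singled out interchangeably. -/
theorem dysonTerm_succ_right {f : ℝ → ℝ → ENNReal} (hf : ∀ v, Measurable fun r => f r v)
    (n : ℕ) (t r v : ℝ) :
    dysonTerm L c (n + 1) t f r v =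
      ∫⁻ s in Ioo 0 t, dysonTerm L c n (t - s) (ecollision c (eadvection L s f)) r v := by
  induction n generalizing t r v with
  | zero =>
    rw [dysonTerm]
    simp only [dysonTerm]
    rw [← setLIntegral_Ioo_reflect]
    simp only [sub_sub_cancel]
  | succ n ih =>
    rw [dysonTerm]
    have h1 : ∀ s, dysonTerm L c (n + 1) (t - s) f = fun r v => ∫⁻ τ in Ioo 0 (t - s),
        dysonTerm L c n (t - s - τ) (ecollision c (eadvection L τ f)) r v :=
      fun s => funext fun r => funext fun v => ih (t - s) r v
    simp only [h1, eadvection_ecollision_lintegral]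
    rw [lintegral_triangle_swap]
    · simp only [dysonTerm]
      have h2 : ∀ s τ : ℝ, t - s - τ = t - τ - s := fun s τ => by ring
      simp only [h2]
    · refine measurable_eadvection (A := ℝ × ℝ)
        (f := fun p => ecollision c
          (dysonTerm L c n (t - p.1 - p.2) (ecollision c (eadvection L p.2 f))))
        (t := fun p => p.1) (ρ := fun _ => r) (fun v' => ?_) (by fun_prop) (by fun_prop) v
      refine Measurable.const_mul ?_ _
      have h3 := measurable_dysonTerm (L := L) (c := c) (A := ℝ)
        (f := fun τ => ecollision c (eadvection L τ f)) (fun v => ?_) n (-v')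
      · exact h3.comp (f := fun p : (ℝ × ℝ) × ℝ => ((p.1.2, t - p.1.1 - p.1.2), p.2)) (by fun_prop)
      · refine Measurable.const_mul ?_ _
        exact measurable_eadvection (A := ℝ × ℝ) (f := fun _ => f) (t := fun p => p.1)
          (ρ := fun p => p.2) (fun v => (hf v).comp measurable_snd) (by fun_prop) (by fun_prop) _

/-! ### Duality under velocity reversal -/

/-- The pairing on `D × V` of `[0, ∞]`-valued functions, written over all of `ℝ`. -/
noncomputable def epairing (υ₀ : ℝ) (f g : ℝ → ℝ → ENNReal) : ENNReal :=
  ∑ v ∈ vel υ₀, ∫⁻ r, f r v * g r v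

theorem sum_vel_neg {M : Type*} [AddCommMonoid M] (F : ℝ → M) :
    ∑ v ∈ vel υ₀, F (-v) = ∑ v ∈ vel υ₀, F v :=
  Finset.sum_nbij' (fun v => -v) (fun v => -v) (fun _ h => neg_mem_vel.2 h)
    (fun _ h => neg_mem_vel.2 h) (fun v _ => neg_neg v) (fun v _ => neg_neg v) (fun _ _ => rfl)

theorem epairing_lintegral {f : ℝ → ℝ → ENNReal} (hf : ∀ v, Measurable fun r => f r v)
    {h : ℝ → ℝ → ℝ → ENNReal} (hh : ∀ v, Measurable fun p : ℝ × ℝ => h p.1 p.2 v) (A : Set ℝ) :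
    epairing υ₀ f (fun r v => ∫⁻ s in A, h s r v) = ∫⁻ s in A, epairing υ₀ f (h s) := by
  have hm : ∀ v, Measurable fun p : ℝ × ℝ => f p.2 v * h p.1 p.2 v := fun v =>
    ((hf v).comp measurable_snd).mul (hh v)
  simp only [epairing]
  rw [lintegral_finsetSum]
  · refine Finset.sum_congr rfl fun v _ => ?_
    rw [lintegral_lintegral_swap (hm v).aemeasurable]
    refine lintegral_congr fun r => ?_
    rw [lintegral_const_mul]
    exact (hh v).comp (f := fun s : ℝ => (s, r)) (by fun_prop)
  · intro v _
    exact (hm v).lintegral_prod_right'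

theorem epairing_lintegral_left {f : ℝ → ℝ → ENNReal} (hf : ∀ v, Measurable fun r => f r v)
    {h : ℝ → ℝ → ℝ → ENNReal} (hh : ∀ v, Measurable fun p : ℝ × ℝ => h p.1 p.2 v) (A : Set ℝ) :
    epairing υ₀ (fun r v => ∫⁻ s in A, h s r v) f = ∫⁻ s in A, epairing υ₀ (h s) f := by
  have h1 := epairing_lintegral (υ₀ := υ₀) hf hh A
  simp only [epairing, mul_comm] at h1 ⊢
  exact h1

/-- Advection is self-adjoint up to velocity reversal. -/
theorem epairing_eadvection {f g : ℝ → ℝ → ENNReal} (hf : ∀ r v, r ∉ dom L → f r v = 0)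
    (hg : ∀ r v, r ∉ dom L → g r v = 0) (t : ℝ) :
    epairing υ₀ f (eadvection L t g) =
      epairing υ₀ (reverse (eadvection L t (reverse f))) g := by
  refine Finset.sum_congr rfl fun v _ => ?_
  have h1 : ∀ r, f r v * eadvection L t g r v = f r v * g (r + v * t) v := fun r => by
    by_cases hr : r ∈ dom L
    · rw [eadvection, indicator_of_mem hr]
    · rw [hf r v hr, zero_mul, zero_mul]
  have h2 : ∀ r, reverse (eadvection L t (reverse f)) r v * g r v =
      f (r - v * t) v * g r v := fun r => by
    by_cases hr : r ∈ dom L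
    · simp only [reverse, eadvection, indicator_of_mem hr, neg_neg]
      congr 2; ring
    · rw [hg r v hr, mul_zero, mul_zero]
  simp only [h1, h2]
  rw [← lintegral_add_right_eq_self (fun r => f (r - v * t) v * g r v) (v * t)]
  simp only [add_sub_cancel_right]

theorem epairing_reverse_ecollision (f g : ℝ → ℝ → ENNReal) :
    epairing υ₀ (reverse f) (ecollision c g) = epairing υ₀ (reverse (ecollision c f)) g := by
  rw [epairing, epairing, ← sum_vel_neg]
  refine Finset.sum_congr rfl fun v _ => ?_
  refine lintegral_congr fun r => ?_
  simp only [reverse, ecollision, neg_neg]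
  ring

/-- Each term of the Dyson series is self-adjoint up to velocity reversal: reversing a path keeps
the number of scatterings and exchanges the first one with the last. -/
theorem epairing_dysonTerm {f g : ℝ → ℝ → ENNReal} (hf : ∀ r v, r ∉ dom L → f r v = 0)
    (hg : ∀ r v, r ∉ dom L → g r v = 0) (hfm : ∀ v, Measurable fun r => f r v)
    (hgm : ∀ v, Measurable fun r => g r v) (n : ℕ) (t : ℝ) :
    epairing υ₀ f (dysonTerm L c n t g) =
      epairing υ₀ (reverse (dysonTerm L c n t (reverse f))) g := by
  induction n generalizing f t with
  | zero => exact epairing_eadvection hf hg t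
  | succ n ih =>
    have hfr : ∀ v, Measurable fun r => reverse f r v := fun v => hfm (-v)
    have hK : ∀ v, Measurable fun p : ℝ × ℝ => ecollision c (eadvection L p.1 (reverse f)) p.2 v :=
      fun v => Measurable.const_mul (measurable_eadvection (A := ℝ × ℝ) (f := fun _ => reverse f)
        (t := fun p => p.1) (ρ := fun p => p.2) (fun v => (hfr v).comp measurable_snd)
        (by fun_prop) (by fun_prop) _) _
    have h1 : dysonTerm L c (n + 1) t g = fun r v =>
      ∫⁻ s in Ioo 0 t, eadvection L s (ecollision c (dysonTerm L c n (t - s) g)) r v := rfl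
    have h2 : reverse (dysonTerm L c (n + 1) t (reverse f)) = fun r v => ∫⁻ s in Ioo 0 t,
        reverse (dysonTerm L c n (t - s) (ecollision c (eadvection L s (reverse f)))) r v :=
      funext fun r => funext fun v => dysonTerm_succ_right hfr n t r (-v)
    rw [h1, h2, epairing_lintegral hfm, epairing_lintegral_left hgm]
    · refine lintegral_congr fun s => ?_
      rw [epairing_eadvection hf, epairing_reverse_ecollision, ih, reverse_reverse]
      · intro r v hr
        simp [reverse, ecollision, eadvection, hr]
      · exact fun v => (hK (-v)).comp (f := fun r : ℝ => (s, r)) (by fun_prop)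
      · intro r v hr
        have : dysonTerm L c n (t - s) g r (-v) = 0 := by
          cases n <;> simp [dysonTerm, eadvection, hr]
        rw [ecollision, this, mul_zero]
    · intro v
      have h3 := measurable_dysonTerm (L := L) (c := c) (A := ℝ)
        (f := fun s => ecollision c (eadvection L s (reverse f))) hK n (-v)
      exact h3.comp (f := fun p : ℝ × ℝ => ((p.1, t - p.1), p.2)) (by fun_prop)
    · intro v
      refine measurable_eadvection (A := ℝ × ℝ)
        (f := fun p => ecollision c (dysonTerm L c n (t - p.1) g))
        (t := fun p => p.1) (ρ := fun p => p.2) (fun v' => ?_) (by fun_prop) (by fun_prop) v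
      refine Measurable.const_mul ?_ _
      exact (measurable_dysonTerm' hgm n (-v')).comp
        (f := fun p : (ℝ × ℝ) × ℝ => (t - p.1.1, p.2)) (by fun_prop)

theorem epairing_dysonSeries {f g : ℝ → ℝ → ENNReal} (hf : ∀ r v, r ∉ dom L → f r v = 0)
    (hg : ∀ r v, r ∉ dom L → g r v = 0) (hfm : ∀ v, Measurable fun r => f r v)
    (hgm : ∀ v, Measurable fun r => g r v) (t : ℝ) :
    epairing υ₀ f (dysonSeries L c t g) =
      epairing υ₀ (reverse (dysonSeries L c t (reverse f))) g := by
  have hm : ∀ {h : ℝ → ℝ → ENNReal} (_ : ∀ v, Measurable fun r => h r v) (n : ℕ) (v : ℝ),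
      Measurable fun r => dysonTerm L c n t h r v := fun hh n v =>
    (measurable_dysonTerm' hh n v).comp (f := fun r : ℝ => (t, r)) (by fun_prop)
  have h1 : epairing υ₀ f (dysonSeries L c t g) = ∑' n, epairing υ₀ f (dysonTerm L c n t g) := by
    simp only [epairing, dysonSeries, ← ENNReal.tsum_mul_left]
    rw [Summable.tsum_finsetSum fun _ _ => ENNReal.summable]
    refine Finset.sum_congr rfl fun v _ => ?_
    exact lintegral_tsum fun n => ((hfm v).mul (hm hgm n v)).aemeasurable
  have h2 : epairing υ₀ (reverse (dysonSeries L c t (reverse f))) g =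
      ∑' n, epairing υ₀ (reverse (dysonTerm L c n t (reverse f))) g := by
    simp only [epairing, dysonSeries, reverse, ← ENNReal.tsum_mul_right]
    rw [Summable.tsum_finsetSum fun _ _ => ENNReal.summable]
    refine Finset.sum_congr rfl fun v _ => ?_
    exact lintegral_tsum fun n =>
      ((hm (h := fun r v => f r (-v)) (fun v => hfm (-v)) n (-v)).mul (hgm v)).aemeasurable
  rw [h1, h2]
  exact tsum_congr fun n => epairing_dysonTerm hf hg hfm hgm n t

/-! ### Convergence of the Dyson series -/

theorem dysonSeries_eq {f : ℝ → ℝ → ENNReal} (hf : ∀ v, Measurable fun r => f r v) {r : ℝ}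
    (hr : r ∈ dom L) (t v : ℝ) :
    dysonSeries L c t f r v =
      f (r + v * t) v + ∫⁻ s in Ioo 0 t, c * dysonSeries L c (t - s) f (r + v * s) (-v) := by
  rw [dysonSeries, tsum_eq_zero_add' ENNReal.summable]
  congr 1
  · simp [dysonTerm, eadvection, hr]
  · simp only [dysonTerm, eadvection_ecollision _ _ _ hr, dysonSeries, ← ENNReal.tsum_mul_left]
    rw [lintegral_tsum]
    intro n
    refine (Measurable.const_mul ?_ _).aemeasurable
    exact (measurable_dysonTerm' hf n (-v)).comp
      (f := fun s : ℝ => (t - s, r + v * s)) (by fun_prop)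

/-- The factor `2⁻¹ ^ n` against `exp (2ct)` makes the series geometric. -/
theorem dysonTerm_le {f : ℝ → ℝ → ENNReal} {C : ENNReal} (hC : ∀ r v, f r v ≤ C)
    (n : ℕ) {t : ℝ} (ht : 0 ≤ t) (r v : ℝ) :
    dysonTerm L c n t f r v ≤ C * 2⁻¹ ^ n * ENNReal.ofReal (Real.exp (2 * c * t)) := by
  have hexp : ∀ {t : ℝ}, 0 ≤ t → 1 ≤ ENNReal.ofReal (Real.exp (2 * c * t)) := fun ht =>
    ENNReal.one_le_ofReal.2 (Real.one_le_exp (by positivity))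
  induction n generalizing t r v with
  | zero =>
    simp only [dysonTerm, eadvection, pow_zero, mul_one]
    refine (indicator_le_self' (fun _ _ => zero_le) r).trans ((hC _ _).trans ?_)
    exact le_mul_of_one_le_right' (hexp ht)
  | succ n ih =>
    simp only [dysonTerm]
    have h1 : ∫⁻ s in Ioo 0 t, eadvection L s (ecollision c (dysonTerm L c n (t - s) f)) r v ≤
        ∫⁻ s in Ioo 0 t, C * 2⁻¹ ^ n * ENNReal.ofReal (c * Real.exp (2 * c * (t - s))) := by
      refine setLIntegral_mono' measurableSet_Ioo fun s hs => ?_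
      refine (indicator_le_self' (fun _ _ => zero_le) r).trans ?_
      rw [ecollision, ENNReal.ofReal_mul c.coe_nonneg, ENNReal.ofReal_coe_nnreal, ← mul_assoc,
        mul_comm (C * 2⁻¹ ^ n) (c : ENNReal), mul_assoc]
      gcongr
      exact ih (by linarith [hs.2]) _ _
    refine h1.trans ?_
    rw [lintegral_const_mul _ (by fun_prop), pow_succ, ← mul_assoc, mul_assoc (C * 2⁻¹ ^ n)]
    gcongr
    rw [restrict_Ioo_eq_restrict_Ioc, ← ofReal_integral_eq_lintegral_ofReal,
      ← intervalIntegral.integral_of_le ht]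
    · have hd : ∀ s, HasDerivAt (fun s => -(1 / 2) * Real.exp (2 * c * (t - s)))
          (c * Real.exp (2 * c * (t - s))) s := fun s => by
        refine (((((hasDerivAt_id' s).const_sub t).const_mul (2 * (c : ℝ))).exp).const_mul
          (-(1 / 2))).congr_deriv ?_
        ring
      rw [intervalIntegral.integral_eq_sub_of_hasDerivAt (fun s _ => hd s)
        ((by fun_prop : Continuous fun s : ℝ =>
          c * Real.exp (2 * c * (t - s))).intervalIntegrable _ _)]
      have : (2⁻¹ : ENNReal) = ENNReal.ofReal 2⁻¹ := by
        rw [ENNReal.ofReal_inv_of_pos (by norm_num)]; simp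
      rw [this, ← ENNReal.ofReal_mul (by norm_num)]
      refine ENNReal.ofReal_le_ofReal ?_
      simp only [sub_self, mul_zero, Real.exp_zero, sub_zero]
      linarith
    · exact ((by fun_prop : Continuous fun s : ℝ =>
          c * Real.exp (2 * c * (t - s))).intervalIntegrable 0 t).1
    · exact Filter.Eventually.of_forall fun s => by positivity

theorem dysonSeries_le {f : ℝ → ℝ → ENNReal} {C : ENNReal} (hC : ∀ r v, f r v ≤ C)
    {t : ℝ} (ht : 0 ≤ t) (r v : ℝ) :
    dysonSeries L c t f r v ≤ C * 2 * ENNReal.ofReal (Real.exp (2 * c * t)) := by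
  refine (ENNReal.tsum_le_tsum fun n => dysonTerm_le hC n ht r v).trans ?_
  rw [ENNReal.tsum_mul_right, ENNReal.tsum_mul_left]
  gcongr
  rw [ENNReal.tsum_geometric, ENNReal.one_sub_inv_two, inv_inv]

/-- A trajectory exists from every bounded measurable non-negative function: it is the sum of the
Dyson series. -/
theorem exists_isTrajectory (hσ : 0 < σ) {g : ℝ → ℝ → ℝ}
    (hg : ∀ r v, ¬(r ∈ dom L ∧ v ∈ vel υ₀) → g r v = 0) (hgm : ∀ v, Measurable fun r => g r v)
    (hg0 : ∀ r v, 0 ≤ g r v) {C : ℝ} (hC : ∀ r v, g r v ≤ C) :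
    ∃ u, IsTrajectory L υ₀ σ 0 u ∧ (∀ r v, u 0 r v = g r v) ∧ ∀ t, 0 ≤ t → ∀ r v,
      ENNReal.ofReal (u t r v) =
        dysonSeries L σ.toNNReal t (fun r v => ENNReal.ofReal (g r v)) r v := by
  set c := σ.toNNReal with hc
  have hcσ : (c : ℝ) = σ := Real.coe_toNNReal σ hσ.le
  set f : ℝ → ℝ → ENNReal := fun r v => ENNReal.ofReal (g r v) with hf
  have hfm : ∀ v, Measurable fun r => f r v := fun v => (hgm v).ennreal_ofReal
  have hf0 : ∀ r v, ¬(r ∈ dom L ∧ v ∈ vel υ₀) → f r v = 0 := fun r v h => by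
    simp [hf, hg r v h]
  have hfC : ∀ r v, f r v ≤ ENNReal.ofReal C := fun r v => ENNReal.ofReal_le_ofReal (hC r v)
  set S := dysonSeries L c with hS
  have hSle : ∀ {t}, 0 ≤ t → ∀ r v,
      S t f r v ≤ ENNReal.ofReal (|C| * 2 * Real.exp (2 * σ * t)) := fun {t} ht r v => by
    have := dysonSeries_le (L := L) (c := c)
      (fun r v => (hfC r v).trans (ENNReal.ofReal_le_ofReal (le_abs_self C))) ht r v
    rw [ENNReal.ofReal_mul (by positivity), ENNReal.ofReal_mul (by positivity), ← hcσ]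
    simpa using this
  have hfin : ∀ {t}, 0 ≤ t → ∀ r v, S t f r v ≠ ⊤ := fun ht r v =>
    ((hSle ht r v).trans_lt ENNReal.ofReal_lt_top).ne
  have hS0 : ∀ t r v, ¬(r ∈ dom L ∧ v ∈ vel υ₀) → S t f r v = 0 := fun t r v h =>
    ENNReal.tsum_eq_zero.2 fun n => dysonTerm_eq_zero hf0 n t h
  have hSm : ∀ v, Measurable fun p : ℝ × ℝ => S p.1 f p.2 v := fun v =>
    Measurable.tsum fun n => measurable_dysonTerm' hfm n v
  have hSinit : ∀ r v, S 0 f r v = f r v := fun r v => by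
    by_cases h : r ∈ dom L ∧ v ∈ vel υ₀
    · rw [hS, dysonSeries_eq hfm h.1]
      simp
    · rw [hS0 0 r v h, hf0 r v h]
  refine ⟨fun t r v => (S t f r v).toReal, ⟨fun t r v h => by rw [hS0 t r v h]; rfl,
    fun v => (hSm v).ennreal_toReal, fun T => ?_, fun t ht r hr v => ?_⟩, fun r v => ?_,
    fun t ht r v => ENNReal.ofReal_toReal (hfin ht r v)⟩
  · refine ⟨|C| * 2 * Real.exp (2 * σ * T), fun t ht r v => ?_⟩
    rw [abs_of_nonneg ENNReal.toReal_nonneg]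
    refine (ENNReal.toReal_le_of_le_ofReal (by positivity) (hSle ht.1 r v)).trans ?_
    have := ht.2
    gcongr
  · have hint : ∫⁻ s in Ioo 0 t, c * S (t - s) f (r + v * s) (-v) =
        ∫⁻ s in Ioc 0 t, ENNReal.ofReal (σ * (S (t - s) f (r + v * s) (-v)).toReal) := by
      rw [restrict_Ioo_eq_restrict_Ioc]
      refine setLIntegral_congr_fun measurableSet_Ioc fun s hs => ?_
      rw [ENNReal.ofReal_mul hσ.le, ENNReal.ofReal_toReal (hfin (by linarith [hs.2]) _ _)]
      rfl
    have heq := dysonSeries_eq (L := L) (c := c) hfm hr t v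
    rw [← hS, hint] at heq
    have hfin' := hfin ht r v
    rw [heq, ENNReal.add_ne_top] at hfin'
    rw [heq, ENNReal.toReal_add hfin'.1 hfin'.2, hSinit, intervalIntegral.integral_of_le ht,
      integral_eq_lintegral_of_nonneg_ae]
    · simp only [zero_mul, add_zero]
    · exact Filter.Eventually.of_forall fun s => by
        simp only [zero_mul, add_zero]; positivity
    · simp only [zero_mul, add_zero]
      refine (Measurable.const_mul (Measurable.ennreal_toReal ?_) σ).aestronglyMeasurable
      exact (hSm (-v)).comp (f := fun s : ℝ => (t - s, r + v * s)) (by fun_prop)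
  · simp only [hSinit]
    exact ENNReal.toReal_ofReal (hg0 r v)

theorem IsTrajectory.measurable_at (hu : IsTrajectory L υ₀ σ 0 u) (t v : ℝ) :
    Measurable fun r => u t r v :=
  (hu.meas v).comp (f := fun r : ℝ => (t, r)) (by fun_prop)

theorem IsTrajectory.ofReal_eq_dysonSeries (hσ : 0 < σ) (hu : IsTrajectory L υ₀ σ 0 u)
    (h0 : ∀ r v, 0 ≤ u 0 r v) {t : ℝ} (ht : 0 ≤ t) (r v : ℝ) :
    ENNReal.ofReal (u t r v) =
      dysonSeries L σ.toNNReal t (fun r v => ENNReal.ofReal (u 0 r v)) r v := by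
  obtain ⟨C, hC⟩ := hu.bdd 0
  obtain ⟨w, hw, hw0, hws⟩ := exists_isTrajectory hσ (fun r v h => hu.supp 0 r v h)
    (hu.measurable_at 0) h0 (fun r v => (le_abs_self _).trans (hC 0 ⟨le_rfl, le_rfl⟩ r v))
  rw [hu.unique hσ hw (fun r v => (hw0 r v).symm) ht, hws t ht]

/-- Reciprocity: the evolution is self-adjoint up to velocity reversal. -/
theorem IsTrajectory.reciprocity (hσ : 0 < σ) (hu : IsTrajectory L υ₀ σ 0 u)
    (hw : IsTrajectory L υ₀ σ 0 w) (hu0 : ∀ r v, 0 ≤ u 0 r v) (hw0 : ∀ r v, 0 ≤ w 0 r v)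
    {t : ℝ} (ht : 0 ≤ t) :
    ∑ v ∈ vel υ₀, ∫ r in dom L, u 0 r (-v) * w t r v =
      ∑ v ∈ vel υ₀, ∫ r in dom L, u t r (-v) * w 0 r v := by
  have hreal : ∀ {a b : ℝ → ℝ → ℝ → ℝ}, IsTrajectory L υ₀ σ 0 a → IsTrajectory L υ₀ σ 0 b →
      (∀ r v, 0 ≤ a 0 r v) → (∀ r v, 0 ≤ b 0 r v) → ∀ {s t : ℝ}, 0 ≤ s → 0 ≤ t → ∀ v,
      ∫ r in dom L, a s r (-v) * b t r v =
        (∫⁻ r, ENNReal.ofReal (a s r (-v)) * ENNReal.ofReal (b t r v)).toReal := by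
    intro a b ha hb ha0 hb0 s t hs ht v
    rw [setIntegral_eq_integral_of_forall_compl_eq_zero fun r hr => by
      rw [hb.supp _ _ _ fun h => hr h.1, mul_zero]]
    rw [integral_eq_lintegral_of_nonneg_ae]
    · congr 1
      exact lintegral_congr fun r => ENNReal.ofReal_mul (ha.nonneg hσ ha0 hs _ _)
    · exact Filter.Eventually.of_forall fun r =>
        mul_nonneg (ha.nonneg hσ ha0 hs _ _) (hb.nonneg hσ hb0 ht _ _)
    · exact ((ha.measurable_at s _).mul (hb.measurable_at t _)).aestronglyMeasurable
  have hfin : ∀ {a b : ℝ → ℝ → ℝ → ℝ}, IsTrajectory L υ₀ σ 0 a → IsTrajectory L υ₀ σ 0 b →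
      ∀ {s t : ℝ}, 0 ≤ s → 0 ≤ t → ∀ v,
      ∫⁻ r, ENNReal.ofReal (a s r (-v)) * ENNReal.ofReal (b t r v) ≠ ⊤ := by
    intro a b ha hb s t hs ht v
    obtain ⟨A, hA⟩ := ha.bdd s
    obtain ⟨B, hB⟩ := hb.bdd t
    refine ((lintegral_mono (g := (dom L).indicator fun _ =>
      ENNReal.ofReal A * ENNReal.ofReal B) fun r => ?_).trans_lt ?_).ne
    · by_cases hr : r ∈ dom L
      · rw [indicator_of_mem hr]
        gcongr
        · exact (le_abs_self _).trans (hA s ⟨hs, le_rfl⟩ _ _)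
        · exact (le_abs_self _).trans (hB t ⟨ht, le_rfl⟩ _ _)
      · simp [hb.supp _ _ _ fun h => hr h.1]
    · rw [lintegral_indicator measurableSet_dom, setLIntegral_const, dom, Real.volume_Ioo]
      exact ENNReal.mul_lt_top (ENNReal.mul_lt_top ENNReal.ofReal_lt_top ENNReal.ofReal_lt_top)
        ENNReal.ofReal_lt_top
  simp only [hreal hu hw hu0 hw0 le_rfl ht, hreal hu hw hu0 hw0 ht le_rfl]
  rw [← ENNReal.toReal_sum fun v _ => hfin hu hw le_rfl ht v,
    ← ENNReal.toReal_sum fun v _ => hfin hu hw ht le_rfl v]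
  congr 1
  have hd := epairing_dysonSeries (υ₀ := υ₀) (L := L) (c := σ.toNNReal) (t := t)
    (f := fun r v => ENNReal.ofReal (u 0 r (-v))) (g := fun r v => ENNReal.ofReal (w 0 r v))
    (fun r v hr => by simp [hu.supp _ _ _ fun h => hr h.1])
    (fun r v hr => by simp [hw.supp _ _ _ fun h => hr h.1])
    (fun v => (hu.measurable_at 0 (-v)).ennreal_ofReal)
    (fun v => (hw.measurable_at 0 v).ennreal_ofReal)
  have hrev : reverse (fun r v => ENNReal.ofReal (u 0 r (-v))) =
      fun r v => ENNReal.ofReal (u 0 r v) := by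
    funext r v; simp [reverse]
  rw [hrev] at hd
  simp only [epairing, reverse, ← hw.ofReal_eq_dysonSeries hσ hw0 ht,
    ← hu.ofReal_eq_dysonSeries hσ hu0 ht] at hd
  exact hd

end Slab

namespace Slab

variable {L υ₀ σ : ℝ} {u : ℝ → ℝ → ℝ → ℝ}

/-! ### Bounds near the exit boundary and minorization -/

/-- The time after which the path from `r ∈ D` with velocity `v = ±υ₀` leaves `D`, as a rational
expression in `v`. -/
noncomputable def timeToExit (L υ₀ r v : ℝ) : ℝ := (L * υ₀ - r * v) / υ₀ ^ 2

theorem timeToExit_right (hυ₀ : 0 < υ₀) (r : ℝ) : timeToExit L υ₀ r υ₀ = (L - r) / υ₀ := by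
  rw [timeToExit]; field_simp

theorem timeToExit_left (hυ₀ : 0 < υ₀) (r : ℝ) : timeToExit L υ₀ r (-υ₀) = (L + r) / υ₀ := by
  rw [timeToExit]; field_simp; ring

theorem timeToExit_pos (hυ₀ : 0 < υ₀) {r v : ℝ} (hr : r ∈ dom L) (hv : v ∈ vel υ₀) :
    0 < timeToExit L υ₀ r v := by
  rcases mem_vel.1 hv with rfl | rfl
  · rw [timeToExit_left hυ₀]; exact div_pos (by linarith [hr.1]) hυ₀
  · rw [timeToExit_right hυ₀]; exact div_pos (by linarith [hr.2]) hυ₀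

theorem timeToExit_le (hυ₀ : 0 < υ₀) {r v : ℝ} (hr : r ∈ dom L) (hv : v ∈ vel υ₀) :
    timeToExit L υ₀ r v ≤ 2 * L / υ₀ := by
  rcases mem_vel.1 hv with rfl | rfl
  · rw [timeToExit_left hυ₀]; gcongr; linarith [hr.2]
  · rw [timeToExit_right hυ₀]; gcongr; linarith [hr.1]

theorem add_mul_timeToExit_notMem (hυ₀ : 0 < υ₀) {r v : ℝ} (hv : v ∈ vel υ₀) :
    r + v * timeToExit L υ₀ r v ∉ dom L := by
  intro h
  rcases mem_vel.1 hv with rfl | rfl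
  · rw [timeToExit_left hυ₀] at h
    have : r + -υ₀ * ((L + r) / υ₀) = -L := by field_simp; ring
    rw [this] at h
    exact lt_irrefl _ h.1
  · rw [timeToExit_right hυ₀] at h
    have : r + v * ((L - r) / v) = L := by field_simp; ring
    rw [this] at h
    exact lt_irrefl _ h.2

namespace IsTrajectory

theorem le_of_le (hσ : 0 < σ) (hu : IsTrajectory L υ₀ σ 0 u) (h0 : ∀ r v, 0 ≤ u 0 r v) {C : ℝ}
    (hC0 : 0 ≤ C) (hC : ∀ r v, u 0 r v ≤ C) {t : ℝ} (ht : 0 ≤ t) (r v : ℝ) :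
    u t r v ≤ C * 2 * Real.exp (2 * σ * t) := by
  have h1 := dysonSeries_le (L := L) (c := σ.toNNReal) (f := fun r v => ENNReal.ofReal (u 0 r v))
    (C := ENNReal.ofReal C) (fun r v => ENNReal.ofReal_le_ofReal (hC r v)) ht r v
  rw [← hu.ofReal_eq_dysonSeries hσ h0 ht, Real.coe_toNNReal σ hσ.le] at h1
  refine (ENNReal.ofReal_le_ofReal_iff (by positivity)).1 (h1.trans_eq ?_)
  rw [ENNReal.ofReal_mul (by positivity), ENNReal.ofReal_mul hC0]
  simp

/-- Once unscattered particles have left, a solution vanishes linearly at the exit boundary. -/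
theorem le_timeToExit (hυ₀ : 0 < υ₀) (hσ : 0 < σ) (hu : IsTrajectory L υ₀ σ 0 u) {M t : ℝ}
    (ht : 2 * L / υ₀ ≤ t) (hM : ∀ s ∈ Icc 0 t, ∀ r v, u s r v ≤ M)
    {r v : ℝ} (hr : r ∈ dom L) (hv : v ∈ vel υ₀) :
    u t r v ≤ σ * M * timeToExit L υ₀ r v := by
  set κ := timeToExit L υ₀ r v with hκ
  have hκ0 : 0 < κ := timeToExit_pos hυ₀ hr hv
  have hκt : κ ≤ t := (timeToExit_le hυ₀ hr hv).trans ht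
  have h1 := (hu.shift (a := t - κ) (by linarith)).mild κ hκ0.le r hr v
  simp only [sub_add_cancel, add_zero, zero_mul] at h1
  rw [h1, hu.supp _ _ _ fun h => add_mul_timeToExit_notMem hυ₀ hv h.1, zero_add]
  have h2 := intervalIntegral.integral_mono_on hκ0.le
    ((hu.shift (a := t - κ) (by linarith)).intervalIntegrable_char (t := κ) r v
      ⟨le_rfl, hκ0.le⟩ ⟨hκ0.le, le_rfl⟩) (intervalIntegrable_const (c := σ * M)) fun s hs => by
        simp only [zero_mul, add_zero]
        gcongr
        exact hM _ ⟨by linarith [hs.2], by linarith [hs.1]⟩ _ _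
  simp only [zero_mul, add_zero] at h2
  refine h2.trans_eq ?_
  simp only [intervalIntegral.integral_const, sub_zero, smul_eq_mul]
  ring

theorem integral_le (hσ : 0 < σ) (hu : IsTrajectory L υ₀ σ 0 u) (h0 : ∀ r v, 0 ≤ u 0 r v)
    {t : ℝ} {r : ℝ} (hr : r ∈ dom L) (v : ℝ) {a b : ℝ} (ha : 0 ≤ a) (hab : a ≤ b) (hb : b ≤ t) :
    ∫ s in a..b, σ * u (t - s) (r + v * s) (-v) ≤ u t r v := by
  have ht : 0 ≤ t := ha.trans (hab.trans hb)
  rw [hu.mild t ht r hr v]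
  have hint := hu.intervalIntegrable_char (t := t) r v ⟨le_rfl, ht⟩ ⟨ht, le_rfl⟩
  simp only [zero_mul, add_zero] at hint ⊢
  refine (intervalIntegral.integral_mono_interval ha hab hb ?_ hint).trans
    (le_add_of_nonneg_left (h0 _ _))
  refine (ae_restrict_iff' measurableSet_Ioc).2 (Filter.Eventually.of_forall fun s hs => ?_)
  exact mul_nonneg hσ.le (hu.nonneg hσ h0 (by linarith [hs.2]) _ _)

theorem advect_le (hσ : 0 < σ) (hu : IsTrajectory L υ₀ σ 0 u) (h0 : ∀ r v, 0 ≤ u 0 r v)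
    {t : ℝ} (ht : 0 ≤ t) {r : ℝ} (hr : r ∈ dom L) (v : ℝ) : u 0 (r + v * t) v ≤ u t r v := by
  rw [hu.mild t ht r hr v]
  simp only [zero_mul, add_zero]
  refine le_add_of_nonneg_right (intervalIntegral.integral_nonneg ht fun s hs => ?_)
  exact mul_nonneg hσ.le (hu.nonneg hσ h0 (by linarith [hs.2]) _ _)

theorem intervalIntegrable_at (hu : IsTrajectory L υ₀ σ 0 u) {t : ℝ} (ht : 0 ≤ t) (v a b : ℝ) :
    IntervalIntegrable (fun r => u t r v) volume a b := by
  obtain ⟨C, hC⟩ := hu.bdd t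
  refine IntervalIntegrable.mono_fun' (g := fun _ => C) intervalIntegrable_const
    (hu.measurable_at t v).aestronglyMeasurable (Filter.Eventually.of_forall fun r => ?_)
  exact hC t ⟨ht, le_rfl⟩ r v

/-- Paths with one scattering reach every point of `(-m, m)` with reversed velocity. -/
theorem one_scattering_le (hυ₀ : 0 < υ₀) (hσ : 0 < σ) (hu : IsTrajectory L υ₀ σ 0 u)
    (h0 : ∀ r v, 0 ≤ u 0 r v) {t r v m : ℝ} (hr : r ∈ dom L) (hv : v ∈ vel υ₀) (hm : 0 ≤ m)
    (h1 : m + |r| ≤ υ₀ * t) (h2 : m + υ₀ * t < L + υ₀ * timeToExit L υ₀ r v) :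
    σ / (2 * υ₀) * ∫ y in -m..m, u 0 y (-v) ≤ u t r v := by
  have hrl := (abs_le.1 (show |r| ≤ υ₀ * t - m by linarith)).1
  have hrr := (abs_le.1 (show |r| ≤ υ₀ * t - m by linarith)).2
  obtain ⟨hr1, hr2⟩ := hr
  have key : ∀ a b : ℝ, 0 ≤ a → a ≤ b → b ≤ t →
      (∀ s ∈ Icc a b, r + v * s ∈ dom L) →
      ∫ s in a..b, σ * u 0 (r - v * t + 2 * v * s) (-v) ≤ u t r v := by
    intro a b ha hab hb hin
    refine le_trans ?_ (hu.integral_le hσ h0 ⟨hr1, hr2⟩ v ha hab hb)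
    have hi := hu.intervalIntegrable_char (t := t) (a := a) (b := b) r v ⟨ha, hab.trans hb⟩
      ⟨ha.trans hab, hb⟩
    simp only [zero_mul, add_zero] at hi
    refine intervalIntegral.integral_mono_on hab ?_ hi fun s hs => ?_
    · obtain ⟨C, hC⟩ := hu.bdd 0
      refine IntervalIntegrable.mono_fun' (g := fun _ => σ * C) intervalIntegrable_const
        ((((hu.measurable_at 0 (-v)).comp (f := fun s => r - v * t + 2 * v * s)
          (by fun_prop))).const_mul σ).aestronglyMeasurable
        (Filter.Eventually.of_forall fun s => ?_)
      simp only [Real.norm_eq_abs, abs_mul, abs_of_pos hσ]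
      gcongr
      exact hC 0 ⟨le_rfl, le_rfl⟩ _ _
    · gcongr
      have := hu.advect_le hσ h0 (t := t - s) (by linarith [hs.2]) (hin s hs) (-v)
      have he : r - v * t + 2 * v * s = r + v * s + -v * (t - s) := by ring
      rwa [he]
  rcases mem_vel.1 hv with rfl | rfl
  · rw [timeToExit_left hυ₀] at h2
    have h3 : υ₀ * ((L + r) / υ₀) = L + r := by field_simp
    rw [h3] at h2
    have ha := key ((r + υ₀ * t - m) / (2 * υ₀)) ((r + υ₀ * t + m) / (2 * υ₀))
      (div_nonneg (by linarith) (by positivity)) (by gcongr; linarith)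
      (by rw [div_le_iff₀ (by positivity)]; linarith) fun s hs => by
        have h4 := (div_le_iff₀ (by positivity)).1 hs.1
        have h5 := (le_div_iff₀ (by positivity)).1 hs.2
        exact ⟨by linarith, by linarith⟩
    refine le_trans (le_of_eq ?_) ha
    rw [intervalIntegral.integral_const_mul]
    have h6 := intervalIntegral.integral_comp_sub_mul (a := (r + υ₀ * t - m) / (2 * υ₀))
      (b := (r + υ₀ * t + m) / (2 * υ₀)) (fun y => u 0 y (- -υ₀))
      (show (2 * υ₀) ≠ 0 by positivity) (r + υ₀ * t)
    have h7 : ∀ s, r - -υ₀ * t + 2 * -υ₀ * s = r + υ₀ * t - 2 * υ₀ * s := fun s => by ring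
    simp only [h7]
    rw [h6]
    have h8 : r + υ₀ * t - 2 * υ₀ * ((r + υ₀ * t + m) / (2 * υ₀)) = -m := by field_simp; ring
    have h9 : r + υ₀ * t - 2 * υ₀ * ((r + υ₀ * t - m) / (2 * υ₀)) = m := by field_simp; ring
    rw [h8, h9, smul_eq_mul]
    ring
  · rw [timeToExit_right hυ₀] at h2
    have h3 : v * ((L - r) / v) = L - r := by field_simp
    rw [h3] at h2
    have ha := key ((v * t - r - m) / (2 * v)) ((v * t - r + m) / (2 * v))
      (div_nonneg (by linarith) (by positivity)) (by gcongr; linarith)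
      (by rw [div_le_iff₀ (by positivity)]; linarith) fun s hs => by
        have h4 := (div_le_iff₀ (by positivity)).1 hs.1
        have h5 := (le_div_iff₀ (by positivity)).1 hs.2
        exact ⟨by linarith, by linarith⟩
    refine le_trans (le_of_eq ?_) ha
    rw [intervalIntegral.integral_const_mul,
      intervalIntegral.integral_comp_add_mul (fun y => u 0 y (-v))
      (show (2 * v) ≠ 0 by positivity) (r - v * t)]
    have h8 : r - v * t + 2 * v * ((v * t - r + m) / (2 * v)) = m := by field_simp; ring
    have h9 : r - v * t + 2 * v * ((v * t - r - m) / (2 * v)) = -m := by field_simp; ring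
    rw [h8, h9, smul_eq_mul]
    ring

/-- Paths with two scatterings, the first one on the way to the exit boundary. The first scattering
time is taken in `[κ/2, 5κ/8]`, with `κ` the time to exit; then the second one leads to any point of
`(-L/2, L/2)` at time `2L/υ₀`. -/
theorem two_scatterings_le (hL : 0 < L) (hυ₀ : 0 < υ₀) (hσ : 0 < σ) (hu : IsTrajectory L υ₀ σ 0 u)
    (h0 : ∀ r v, 0 ≤ u 0 r v) {r v : ℝ} (hr : r ∈ dom L) (hv : v ∈ vel υ₀) :
    σ ^ 2 / (16 * υ₀) * timeToExit L υ₀ r v * ∫ y in -(L / 2)..L / 2, u 0 y v ≤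
      u (2 * L / υ₀) r v := by
  set κ := timeToExit L υ₀ r v with hκ
  set T := 2 * L / υ₀ with hT
  have hκ0 : 0 < κ := timeToExit_pos hυ₀ hr hv
  have hκT : κ ≤ T := timeToExit_le hυ₀ hr hv
  have hυT : υ₀ * T = 2 * L := by rw [hT]; field_simp
  refine le_trans ?_ (hu.integral_le hσ h0 hr v (a := κ / 2) (b := 5 * κ / 8) (by linarith)
    (by linarith) (by linarith))
  have hi := hu.intervalIntegrable_char (t := T) (a := κ / 2) (b := 5 * κ / 8) r v
    ⟨by linarith, by linarith⟩ ⟨by linarith, by linarith⟩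
  simp only [zero_mul, add_zero] at hi
  have hmono := intervalIntegral.integral_mono_on (by linarith)
    (intervalIntegrable_const (c := σ * (σ / (2 * υ₀) * ∫ y in -(L / 2)..L / 2, u 0 y v))) hi
    fun s hs => by
      have hv' := neg_mem_vel.2 hv
      obtain ⟨hs1, hs2⟩ := hs
      have e1 : υ₀ * (T - s) = 2 * L - υ₀ * s := by rw [mul_sub, hυT]
      have b1 := mul_le_mul_of_nonneg_left hs1 hυ₀.le
      have b2 := mul_le_mul_of_nonneg_left hs2 hυ₀.le
      have hloc : r + v * s ∈ dom L ∧ L / 2 + |r + v * s| ≤ υ₀ * (T - s) ∧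
          L / 2 + υ₀ * (T - s) < L + υ₀ * timeToExit L υ₀ (r + v * s) (-v) := by
        rw [e1]
        obtain ⟨hr1, hr2⟩ := hr
        rcases mem_vel.1 hv with rfl | rfl
        · rw [neg_neg, timeToExit_right hυ₀]
          have e2 : υ₀ * ((L - (r + -υ₀ * s)) / υ₀) = L - (r - υ₀ * s) := by field_simp; ring
          have e3 : υ₀ * κ = L + r := by rw [hκ, timeToExit_left hυ₀]; field_simp
          rw [e2]
          refine ⟨⟨by linarith, by linarith⟩, ?_, by linarith⟩
          rw [← le_sub_iff_add_le', abs_le]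
          constructor <;> linarith
        · rw [timeToExit_left hυ₀]
          have e2 : v * ((L + (r + v * s)) / v) = L + (r + v * s) := by field_simp
          have e3 : v * κ = L - r := by rw [hκ, timeToExit_right hυ₀]; field_simp
          rw [e2]
          refine ⟨⟨by linarith, by linarith⟩, ?_, by linarith⟩
          rw [← le_sub_iff_add_le', abs_le]
          constructor <;> linarith
      have := hu.one_scattering_le hυ₀ hσ h0 hloc.1 hv' (by linarith : 0 ≤ L / 2) hloc.2.1 hloc.2.2
      rw [neg_neg] at this
      gcongr
  refine le_trans (le_of_eq ?_) hmono
  simp only [intervalIntegral.integral_const, smul_eq_mul]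
  field_simp
  ring

/-- Minorization, uniform over `D × V`: at time `2L/υ₀ + L/(4υ₀)` the solution dominates a multiple
of the time to exit times the initial mass with velocity `υ₀` near the origin. The extra time
`L/(4υ₀)` serves to make the velocity of the target the same for both starting velocities. -/
theorem minorization (hL : 0 < L) (hυ₀ : 0 < υ₀) (hσ : 0 < σ) :
    ∃ δ, 0 < δ ∧ ∀ u, IsTrajectory L υ₀ σ 0 u → (∀ r v, 0 ≤ u 0 r v) →
      ∀ r ∈ dom L, ∀ v ∈ vel υ₀,
      δ * timeToExit L υ₀ r v * ∫ y in -(L / 8)..L / 8, u 0 y υ₀ ≤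
        u (L / (4 * υ₀) + 2 * L / υ₀) r v := by
  refine ⟨σ ^ 2 / (16 * υ₀) * min 1 (L / 4 * (σ / (2 * υ₀))), by positivity,
    fun u hu h0 r hr v hv => ?_⟩
  set h := L / (4 * υ₀) with hh
  have hh0 : 0 ≤ h := by positivity
  have hυh : υ₀ * h = L / 4 := by rw [hh]; field_simp
  have hpos : ∀ r v, 0 ≤ u (h + 0) r v := fun r v => hu.nonneg hσ h0 (by linarith) r v
  have h1 := (hu.shift hh0).two_scatterings_le hL hυ₀ hσ hpos hr hv
  refine le_trans ?_ h1
  rw [mul_right_comm (σ ^ 2 / (16 * υ₀)), mul_assoc]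
  have hκ := timeToExit_pos hυ₀ hr hv
  refine mul_le_mul_of_nonneg_left ?_ (by positivity)
  rw [add_zero]
  set N := ∫ y in -(L / 8)..L / 8, u 0 y υ₀ with hN
  have hN0 : 0 ≤ N := intervalIntegral.integral_nonneg (by linarith) fun y _ => h0 _ _
  have hnn : ∀ v a b, 0 ≤ᵐ[volume.restrict (Ioc a b)] fun y => u h y v := fun v a b =>
    Filter.Eventually.of_forall fun y => hu.nonneg hσ h0 hh0 y v
  rcases mem_vel.1 hv with rfl | rfl
  · refine (mul_le_mul_of_nonneg_right (min_le_right _ _) hN0).trans ?_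
    refine le_trans ?_ (intervalIntegral.integral_mono_interval (a := -(L / 8)) (b := L / 8)
      (by linarith) (by linarith) (by linarith) (hnn _ _ _)
      (hu.intervalIntegrable_at hh0 (-υ₀) _ _))
    have hmono := intervalIntegral.integral_mono_on (a := -(L / 8)) (b := L / 8) (by linarith)
      (intervalIntegrable_const (c := σ / (2 * υ₀) * N))
      (hu.intervalIntegrable_at hh0 (-υ₀) _ _) fun y hy => by
        have hy' : |y| ≤ L / 8 := abs_le.2 hy
        have := hu.one_scattering_le hυ₀ hσ h0 (t := h) (r := y) (v := -υ₀) (m := L / 8)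
          ⟨by linarith [hy.1], by linarith [hy.2]⟩ hv (by linarith) (by linarith) (by
            rw [timeToExit_left hυ₀, hυh]
            have : υ₀ * ((L + y) / υ₀) = L + y := by field_simp
            linarith [hy.1])
        rwa [neg_neg] at this
    refine le_trans (le_of_eq ?_) hmono
    simp only [intervalIntegral.integral_const, smul_eq_mul]
    ring
  · refine (mul_le_mul_of_nonneg_right (min_le_left _ _) hN0).trans ?_
    rw [one_mul]
    have h2 : N ≤ ∫ y in (-(L / 2) + L / 4)..(L / 2 + L / 4), u 0 y v :=
      intervalIntegral.integral_mono_interval (by linarith) (by linarith) (by linarith)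
        (Filter.Eventually.of_forall fun y => h0 y v) (hu.intervalIntegrable_at le_rfl v _ _)
    refine h2.trans ?_
    rw [← intervalIntegral.integral_comp_add_right (fun y => u 0 y v)]
    have hi : IntervalIntegrable (fun y => u 0 (y + L / 4) v) volume (-(L / 2)) (L / 2) := by
      simpa using (hu.intervalIntegrable_at le_rfl v (-(L / 2) + L / 4)
        (L / 2 + L / 4)).comp_add_right (L / 4)
    refine intervalIntegral.integral_mono_on (by linarith) hi
      (hu.intervalIntegrable_at hh0 v _ _) fun y hy => ?_
    have := hu.advect_le hσ h0 hh0 (r := y) ⟨by linarith [hy.1], by linarith [hy.2]⟩ v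
    rwa [hυh] at this

end IsTrajectory

end Slab

namespace Slab

variable {L υ₀ σ β : ℝ} {φ : ℝ → ℝ → ℝ} {u : ℝ → ℝ → ℝ → ℝ}

/-! ### Ground states and geometric contraction -/

/-- A positive eigenfunction `φ` of the evolution with eigenvalue `β`, comparable to the time to
exit. It is extended by zero. -/
structure IsGroundState (L υ₀ σ β : ℝ) (φ : ℝ → ℝ → ℝ) : Prop where
  traj : IsTrajectory L υ₀ σ 0 fun t r v => Real.exp (β * t) * φ r v
  lower : ∃ a, 0 < a ∧ ∀ r ∈ dom L, ∀ v ∈ vel υ₀, a * timeToExit L υ₀ r v ≤ φ r v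
  upper : ∃ b, 0 < b ∧ ∀ r ∈ dom L, ∀ v ∈ vel υ₀, φ r v ≤ b * timeToExit L υ₀ r v

namespace IsGroundState

theorem supp (hφ : IsGroundState L υ₀ σ β φ) {r v : ℝ} (h : ¬(r ∈ dom L ∧ v ∈ vel υ₀)) :
    φ r v = 0 := by
  simpa using hφ.traj.supp 0 r v h

theorem pos (hυ₀ : 0 < υ₀) (hφ : IsGroundState L υ₀ σ β φ) {r v : ℝ} (hr : r ∈ dom L)
    (hv : v ∈ vel υ₀) : 0 < φ r v := by
  obtain ⟨a, ha, h⟩ := hφ.lower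
  exact (mul_pos ha (timeToExit_pos hυ₀ hr hv)).trans_le (h r hr v hv)

theorem nonneg (hυ₀ : 0 < υ₀) (hφ : IsGroundState L υ₀ σ β φ) (r v : ℝ) : 0 ≤ φ r v := by
  by_cases h : r ∈ dom L ∧ v ∈ vel υ₀
  · exact (hφ.pos hυ₀ h.1 h.2).le
  · exact (hφ.supp h).ge

/-- At time `t` the trajectory lies between `m` and `M` times the ground state, in the
normalisation that makes the ground state stationary. -/
def Between (β : ℝ) (φ : ℝ → ℝ → ℝ) (u : ℝ → ℝ → ℝ → ℝ) (t m M : ℝ) : Prop :=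
  ∀ r v, m * (Real.exp (β * t) * φ r v) ≤ u t r v ∧ u t r v ≤ M * (Real.exp (β * t) * φ r v)

theorem Between.le (hL : 0 < L) (hυ₀ : 0 < υ₀) (hφ : IsGroundState L υ₀ σ β φ) {t m M : ℝ}
    (h : Between β φ u t m M) : m ≤ M := by
  have hpos : 0 < Real.exp (β * t) * φ 0 υ₀ :=
    mul_pos (Real.exp_pos _) (hφ.pos hυ₀ ⟨by linarith, hL⟩ (mem_vel.2 (Or.inr rfl)))
  exact le_of_mul_le_mul_right ((h 0 υ₀).1.trans (h 0 υ₀).2) hpos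

theorem Between.add (hσ : 0 < σ) (hφ : IsGroundState L υ₀ σ β φ) (hu : IsTrajectory L υ₀ σ 0 u)
    {t s m M : ℝ} (ht : 0 ≤ t) (hs : 0 ≤ s) (h : Between β φ u t m M) :
    Between β φ u (t + s) m M := by
  intro r v
  have h1 := ((hu.shift ht).sub_smul (hφ.traj.shift ht) 1 m).nonneg hσ
    (fun r v => by have := (h r v).1; simp only [add_zero]; linarith) hs r v
  have h2 := ((hφ.traj.shift ht).sub_smul (hu.shift ht) M 1).nonneg hσ
    (fun r v => by have := (h r v).2; simp only [add_zero]; linarith) hs r v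
  constructor <;> linarith

/-- One Doeblin step: the minorization, applied to `u - m φ` and to `M φ - u`, narrows the range
`[m, M]` by a factor `q < 1` independent of the trajectory. -/
theorem exists_contraction (hL : 0 < L) (hυ₀ : 0 < υ₀) (hσ : 0 < σ)
    (hφ : IsGroundState L υ₀ σ β φ) :
    ∃ T q, 0 < T ∧ 0 < q ∧ q < 1 ∧ ∀ u, IsTrajectory L υ₀ σ 0 u → ∀ t m M, 0 ≤ t →
      Between β φ u t m M → ∃ m' M', Between β φ u (t + T) m' M' ∧ M' - m' ≤ q * (M - m) := by
  obtain ⟨δ, hδ, hmin⟩ := IsTrajectory.minorization (υ₀ := υ₀) hL hυ₀ hσ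
  obtain ⟨b, hb, hφb⟩ := hφ.upper
  set T := L / (4 * υ₀) + 2 * L / υ₀ with hT
  have hT0 : 0 < T := by positivity
  have hφint : IntervalIntegrable (fun y => φ y υ₀) volume (-(L / 8)) (L / 8) := by
    simpa using hφ.traj.intervalIntegrable_at le_rfl υ₀ (-(L / 8)) (L / 8)
  set N := ∫ y in -(L / 8)..L / 8, φ y υ₀ with hN
  have hNpos : 0 < N :=
    intervalIntegral.intervalIntegral_pos_of_pos_on hφint (fun y hy =>
      hφ.pos hυ₀ ⟨by linarith [hy.1], by linarith [hy.2]⟩ (mem_vel.2 (Or.inr rfl))) (by linarith)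
  set ε := δ / b * Real.exp (-(β * T)) with hε
  have hε0 : 0 < ε := by positivity
  -- the minorization, with the time to exit replaced by the ground state
  have hmin' : ∀ w, IsTrajectory L υ₀ σ 0 w → (∀ r v, 0 ≤ w 0 r v) → ∀ r v,
      ε * (∫ y in -(L / 8)..L / 8, w 0 y υ₀) * (Real.exp (β * T) * φ r v) ≤ w T r v := by
    intro w hw hw0 r v
    by_cases h : r ∈ dom L ∧ v ∈ vel υ₀
    · refine le_trans ?_ (hmin w hw hw0 r h.1 v h.2)
      have hI : 0 ≤ ∫ y in -(L / 8)..L / 8, w 0 y υ₀ :=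
        intervalIntegral.integral_nonneg (by linarith) fun y _ => hw0 _ _
      have h1 : φ r v / b ≤ timeToExit L υ₀ r v := by
        rw [div_le_iff₀ hb, mul_comm]; exact hφb r h.1 v h.2
      have h2 : Real.exp (-(β * T)) * Real.exp (β * T) = 1 := by rw [← Real.exp_add]; simp
      calc ε * (∫ y in -(L / 8)..L / 8, w 0 y υ₀) * (Real.exp (β * T) * φ r v)
          = δ * (φ r v / b) * (∫ y in -(L / 8)..L / 8, w 0 y υ₀) *
              (Real.exp (-(β * T)) * Real.exp (β * T)) := by rw [hε]; ring
        _ ≤ _ := by rw [h2, mul_one]; gcongr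
    · rw [hφ.supp h, hw.supp _ _ _ h]; simp
  -- the minimum keeps the contraction factor positive
  refine ⟨T, 1 - min (ε * N) (1 / 2), hT0, by linarith [min_le_right (ε * N) (1 / 2)],
    by linarith [lt_min (mul_pos hε0 hNpos) (by norm_num : (0 : ℝ) < 1 / 2)],
    fun u hu t m M ht hB => ?_⟩
  have hmM : m ≤ M := Between.le hL hυ₀ hφ hB
  set I := ∫ y in -(L / 8)..L / 8, u t y υ₀ with hI
  have hIint := hu.intervalIntegrable_at ht υ₀ (-(L / 8)) (L / 8)
  set E := Real.exp (β * t) with hE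
  have hE0 : 0 < E := Real.exp_pos _
  have hEadd : Real.exp (β * (t + T)) = E * Real.exp (β * T) := by
    rw [hE, ← Real.exp_add]; ring_nf
  have h1 := hmin' _ ((hu.shift ht).sub_smul (hφ.traj.shift ht) 1 m)
    (fun r v => by have := (hB r v).1; simp only [add_zero]; linarith)
  have h2 := hmin' _ ((hφ.traj.shift ht).sub_smul (hu.shift ht) M 1)
    (fun r v => by have := (hB r v).2; simp only [add_zero]; linarith)
  have e1 : ∫ y in -(L / 8)..L / 8, (1 * u (t + 0) y υ₀ - m * (Real.exp (β * (t + 0)) * φ y υ₀)) =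
      I - m * (E * N) := by
    simp only [add_zero, one_mul]
    rw [intervalIntegral.integral_sub hIint ((hφint.const_mul _).const_mul _),
      intervalIntegral.integral_const_mul, intervalIntegral.integral_const_mul]
  have e2 : ∫ y in -(L / 8)..L / 8, (M * (Real.exp (β * (t + 0)) * φ y υ₀) - 1 * u (t + 0) y υ₀) =
      M * (E * N) - I := by
    simp only [add_zero, one_mul]
    rw [intervalIntegral.integral_sub ((hφint.const_mul _).const_mul _) hIint,
      intervalIntegral.integral_const_mul, intervalIntegral.integral_const_mul]
  refine ⟨m + ε * (I / E - m * N), M - ε * (M * N - I / E), fun r v => ⟨?_, ?_⟩, ?_⟩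
  · have := h1 r v
    rw [e1] at this
    have e3 : (m + ε * (I / E - m * N)) * (Real.exp (β * (t + T)) * φ r v) =
        m * (Real.exp (β * (t + T)) * φ r v) +
          ε * (I - m * (E * N)) * (Real.exp (β * T) * φ r v) := by
      rw [hEadd]; field_simp
    rw [e3]; linarith
  · have := h2 r v
    rw [e2] at this
    have e3 : (M - ε * (M * N - I / E)) * (Real.exp (β * (t + T)) * φ r v) =
        M * (Real.exp (β * (t + T)) * φ r v) -
          ε * (M * (E * N) - I) * (Real.exp (β * T) * φ r v) := by
      rw [hEadd]; field_simp
    rw [e3]; linarith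
  · have e4 : M - ε * (M * N - I / E) - (m + ε * (I / E - m * N)) = (1 - ε * N) * (M - m) := by
      ring
    rw [e4]
    have := min_le_left (ε * N) (1 / 2)
    exact mul_le_mul_of_nonneg_right (by linarith) (by linarith)

/-- Exponential convergence, uniformly over the trajectories that start below `1`. -/
theorem exists_between (hL : 0 < L) (hυ₀ : 0 < υ₀) (hσ : 0 < σ) (hφ : IsGroundState L υ₀ σ β φ) :
    ∃ ε C t₀, 0 < ε ∧ 0 ≤ t₀ ∧ ∀ u, IsTrajectory L υ₀ σ 0 u → (∀ r v, 0 ≤ u 0 r v) →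
      (∀ r v, u 0 r v ≤ 1) → ∀ t, t₀ ≤ t →
      ∃ m M, Between β φ u t m M ∧ M - m ≤ C * Real.exp (-ε * t) := by
  obtain ⟨T, q, hT, hq, hq1, hstep⟩ := hφ.exists_contraction hL hυ₀ hσ
  obtain ⟨a, ha, hφa⟩ := hφ.lower
  set t₀ := 2 * L / υ₀ with ht₀
  have ht₀0 : 0 ≤ t₀ := by positivity
  set B := 2 * Real.exp (2 * σ * t₀) with hB
  set M₀ := σ * B / a * Real.exp (-(β * t₀)) with hM₀
  have hM₀0 : 0 ≤ M₀ := by positivity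
  have hlog : Real.log q < 0 := Real.log_neg hq hq1
  refine ⟨-Real.log q / T, M₀ * Real.exp (-Real.log q * (t₀ / T + 1)), t₀,
    div_pos (by linarith) hT, ht₀0, fun u hu h0 h1 t ht => ?_⟩
  have hbase : Between β φ u t₀ 0 M₀ := by
    intro r v
    refine ⟨by rw [zero_mul]; exact hu.nonneg hσ h0 ht₀0 r v, ?_⟩
    by_cases h : r ∈ dom L ∧ v ∈ vel υ₀
    · have hle := hu.le_timeToExit hυ₀ hσ (M := B) (t := t₀) le_rfl (fun s hs r v => by
        have := hu.le_of_le hσ h0 zero_le_one h1 hs.1 r v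
        rw [one_mul] at this
        have h2 := hs.2
        refine this.trans ?_
        rw [hB]; gcongr) h.1 h.2
      refine hle.trans ?_
      have h2 : Real.exp (-(β * t₀)) * Real.exp (β * t₀) = 1 := by rw [← Real.exp_add]; simp
      have h3 : timeToExit L υ₀ r v ≤ φ r v / a := by
        rw [le_div_iff₀ ha, mul_comm]; exact hφa r h.1 v h.2
      calc σ * B * timeToExit L υ₀ r v ≤ σ * B * (φ r v / a) := by gcongr
        _ = σ * B * (φ r v / a) * (Real.exp (-(β * t₀)) * Real.exp (β * t₀)) := by
          rw [h2, mul_one]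
        _ = _ := by rw [hM₀]; ring
    · rw [hu.supp _ _ _ h, hφ.supp h]; simp
  have hiter : ∀ n : ℕ, ∃ m M, Between β φ u (t₀ + n * T) m M ∧ M - m ≤ q ^ n * M₀ := by
    intro n
    induction n with
    | zero => exact ⟨0, M₀, by simpa using hbase, by simp⟩
    | succ n ih =>
      obtain ⟨m, M, hmM, hle⟩ := ih
      obtain ⟨m', M', hmM', hle'⟩ := hstep u hu _ m M (by positivity) hmM
      refine ⟨m', M', ?_, hle'.trans ?_⟩
      · have : t₀ + (n + 1 : ℕ) * T = t₀ + n * T + T := by push_cast; ring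
        rwa [this]
      · rw [pow_succ, mul_comm (q ^ n) q, mul_assoc]
        gcongr
  set n := ⌊(t - t₀) / T⌋₊ with hn
  have hn1 : n * T ≤ t - t₀ := by
    rw [← le_div_iff₀ hT]
    exact Nat.floor_le (div_nonneg (by linarith) hT.le)
  have hn2 : (t - t₀) / T < n + 1 := Nat.lt_floor_add_one _
  obtain ⟨m, M, hmM, hle⟩ := hiter n
  refine ⟨m, M, ?_, hle.trans ?_⟩
  · have := hmM.add hσ hφ hu (s := t - t₀ - n * T) (by positivity) (by linarith)
    rwa [show t₀ + n * T + (t - t₀ - n * T) = t by ring] at this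
  · have hqn : q ^ n = Real.exp (n * Real.log q) := by rw [Real.exp_nat_mul, Real.exp_log hq]
    rw [mul_comm (q ^ n), mul_assoc M₀, ← Real.exp_add, hqn]
    gcongr
    have h3 : t / T - t₀ / T < n + 1 := by rwa [← sub_div]
    have h4 : -(-Real.log q / T) * t = Real.log q * (t / T) := by ring
    rw [h4]
    nlinarith

theorem left_eigen (hυ₀ : 0 < υ₀) (hσ : 0 < σ) (hφ : IsGroundState L υ₀ σ β φ)
    (hu : IsTrajectory L υ₀ σ 0 u) (h0 : ∀ r v, 0 ≤ u 0 r v) {t : ℝ} (ht : 0 ≤ t) :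
    pairing L υ₀ (fun r v => φ r (-v)) (u t) =
      Real.exp (β * t) * pairing L υ₀ (fun r v => φ r (-v)) (u 0) := by
  have h := hφ.traj.reciprocity hσ hu
    (fun r v => mul_nonneg (Real.exp_pos _).le (hφ.nonneg hυ₀ r v)) h0 ht
  simp only [mul_zero, Real.exp_zero, one_mul, mul_assoc, integral_const_mul] at h
  rw [pairing, pairing, h, Finset.mul_sum]

end IsGroundState

/-! ### Pairings -/

theorem MemLinftyPlus.measurable_zeroExt {g : ℝ → ℝ → ℝ} (hg : MemLinftyPlus L υ₀ g) (v : ℝ) :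
    Measurable fun r => zeroExt L υ₀ g r v := by
  classical
  by_cases hv : v ∈ vel υ₀
  · have h : Measurable fun r : ℝ => if hr : r ∈ dom L then g r v else 0 :=
      Measurable.dite (f := fun r : dom L => g r v) (g := fun _ => 0) (hg.measurable v hv)
        measurable_const measurableSet_dom
    convert h using 2 with r
    by_cases hr : r ∈ dom L <;> simp [zeroExt, hr, hv]
  · simp only [zeroExt_of_not_mem fun h : _ ∧ _ => hv h.2]
    exact measurable_const

theorem MemLinftyPlus.zeroExt_nonneg {g : ℝ → ℝ → ℝ} (hg : MemLinftyPlus L υ₀ g) (r v : ℝ) :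
    0 ≤ zeroExt L υ₀ g r v := by
  by_cases h : r ∈ dom L ∧ v ∈ vel υ₀
  · rw [zeroExt_of_mem h.1 h.2]; exact hg.nonneg r h.1 v h.2
  · rw [zeroExt_of_not_mem h]

theorem pairing_congr {f f' g g' : ℝ → ℝ → ℝ} (hf : ∀ r ∈ dom L, ∀ v ∈ vel υ₀, f r v = f' r v)
    (hg : ∀ r ∈ dom L, ∀ v ∈ vel υ₀, g r v = g' r v) :
    pairing L υ₀ f g = pairing L υ₀ f' g' :=
  Finset.sum_congr rfl fun v hv => setIntegral_congr_fun measurableSet_dom fun r hr => by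
    simp only [hf r hr v hv, hg r hr v hv]

theorem MemLinftyPlus.integrableOn_mul {f g : ℝ → ℝ → ℝ} (hf : MemLinftyPlus L υ₀ f)
    (hg : MemLinftyPlus L υ₀ g) {v : ℝ} (hv : v ∈ vel υ₀) :
    IntegrableOn (fun r => f r v * g r v) (dom L) := by
  obtain ⟨C, hC⟩ := hf.bounded
  obtain ⟨C', hC'⟩ := hg.bounded
  have h : IntegrableOn (fun r => zeroExt L υ₀ f r v * zeroExt L υ₀ g r v) (dom L) := by
    refine Measure.integrableOn_of_bounded (M := |C| * |C'|) (by simp [dom])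
      ((hf.measurable_zeroExt v).mul (hg.measurable_zeroExt v)).aestronglyMeasurable ?_
    refine (ae_restrict_iff' measurableSet_dom).2 (Filter.Eventually.of_forall fun r hr => ?_)
    rw [Real.norm_eq_abs, abs_mul, abs_of_nonneg (hf.zeroExt_nonneg r v),
      abs_of_nonneg (hg.zeroExt_nonneg r v), zeroExt_of_mem hr hv, zeroExt_of_mem hr hv]
    have := hg.nonneg r hr v hv
    gcongr
    · exact (hC r hr v hv).trans (le_abs_self _)
    · exact (hC' r hr v hv).trans (le_abs_self _)
  refine h.congr_fun (fun r hr => ?_) measurableSet_dom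
  simp only [zeroExt_of_mem hr hv]

theorem memLinftyPlus_one : MemLinftyPlus L υ₀ fun _ _ => 1 :=
  ⟨fun _ _ => measurable_const, fun _ _ _ _ => zero_le_one, 1, fun _ _ _ _ => le_rfl⟩

end Slab

namespace Slab

variable {L υ₀ σ σs σf β : ℝ} {φ : ℝ → ℝ → ℝ} {u : ℝ → ℝ → ℝ → ℝ}
  {ψ : ℝ → (ℝ → ℝ → ℝ) → ℝ → ℝ → ℝ}

/-! ### Uniqueness of the leading eigentriple -/

theorem eq_zero_of_tendsto_exp {δ ℓ : ℝ} (hℓ : 0 < ℓ)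
    (h : Filter.Tendsto (fun t => Real.exp (δ * t)) Filter.atTop (nhds ℓ)) : δ = 0 := by
  rcases lt_trichotomy δ 0 with hδ | hδ | hδ
  · have h1 := Real.tendsto_exp_atBot.comp (Filter.tendsto_id.const_mul_atTop_of_neg hδ)
    exact absurd (tendsto_nhds_unique h h1) hℓ.ne'
  · exact hδ
  · have h1 := Real.tendsto_exp_atTop.comp (Filter.tendsto_id.const_mul_atTop hδ)
    exact absurd h (not_tendsto_nhds_of_tendsto_atTop h1 ℓ)

namespace IsLeadEigentriple

variable {lam lam' : ℝ} {φ' φt φt' : ℝ → ℝ → ℝ}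

theorem tendsto (h : IsLeadEigentriple L υ₀ ψ lam φ φt) {g : ℝ → ℝ → ℝ}
    (hg : MemLinftyPlus L υ₀ g) (hg1 : ∀ r ∈ dom L, ∀ v ∈ vel υ₀, g r v ≤ 1) {r v : ℝ}
    (hr : r ∈ dom L) (hv : v ∈ vel υ₀) :
    Filter.Tendsto (fun t => Real.exp (-lam * t) * ψ t g r v) Filter.atTop
      (nhds (φ r v * pairing L υ₀ φt g)) := by
  obtain ⟨ε, hε, C, t₀, hC⟩ := h.asymptotics
  have hφ := h.right_pos r hr v hv
  have h1 : Filter.Tendsto (fun t => Real.exp (-lam * t) * (φ r v)⁻¹ * ψ t g r v) Filter.atTop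
      (nhds (pairing L υ₀ φt g)) := by
    rw [tendsto_iff_dist_tendsto_zero]
    have h2 : Filter.Tendsto (fun t => C * Real.exp (-ε * t)) Filter.atTop (nhds (C * 0)) :=
      (Real.tendsto_exp_atBot.comp
        (Filter.tendsto_id.const_mul_atTop_of_neg (neg_lt_zero.2 hε))).const_mul C
    rw [mul_zero] at h2
    refine squeeze_zero' (Filter.Eventually.of_forall fun t => dist_nonneg) ?_ h2
    filter_upwards [Filter.eventually_ge_atTop t₀] with t ht
    exact hC t ht g hg hg1 r hr v hv
  refine (h1.const_mul (φ r v)).congr fun t => ?_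
  field_simp

/-- This excludes `φt = 0`, for which the asymptotics would give no growth rate. -/
theorem pairing_one_pos (hL : 0 < L) (h : IsLeadEigentriple L υ₀ ψ lam φ φt) :
    0 < pairing L υ₀ φt fun _ _ => 1 := by
  have hK : Icc (-(L / 2)) (L / 2) ⊆ dom L := fun r hr =>
    ⟨by linarith [hr.1], by linarith [hr.2]⟩
  obtain ⟨c, hc, hle⟩ := h.left_away _ isCompact_Icc hK
  refine Finset.sum_pos (fun v hv => ?_) ⟨υ₀, mem_vel.2 (Or.inr rfl)⟩
  have hint := h.left_mem.integrableOn_mul memLinftyPlus_one hv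
  have h1 : ∫ r in Icc (-(L / 2)) (L / 2), φt r v * 1 ≤ ∫ r in dom L, φt r v * 1 := by
    refine setIntegral_mono_set hint ?_ hK.eventuallyLE
    refine (ae_restrict_iff' measurableSet_dom).2 (Filter.Eventually.of_forall fun r hr => ?_)
    simpa using h.left_mem.nonneg r hr v hv
  refine lt_of_lt_of_le ?_ h1
  have h2 : ∫ _ in Icc (-(L / 2)) (L / 2), c ≤ ∫ r in Icc (-(L / 2)) (L / 2), φt r v * 1 := by
    refine setIntegral_mono_ae_restrict (by simp) (hint.mono_set hK) ?_
    filter_upwards [hle v hv] with r hr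
    simpa using hr
  refine lt_of_lt_of_le ?_ h2
  rw [setIntegral_const, smul_eq_mul, Real.volume_real_Icc_of_le (by linarith)]
  have : 0 < L / 2 - -(L / 2) := by linarith
  positivity

/-- The asymptotics determine the triple up to constants: the growth of `ψ t 1` gives the
eigenvalue and the right eigenfunction, and that of `ψ t g`, with `g` an indicator function, the
left one. -/
theorem unique (hL : 0 < L) (h : IsLeadEigentriple L υ₀ ψ lam φ φt)
    (h' : IsLeadEigentriple L υ₀ ψ lam' φ' φt') :
    lam' = lam ∧
    (∃ a : ℝ, 0 < a ∧ ∀ r ∈ dom L, ∀ υ ∈ vel υ₀, φ' r υ = a * φ r υ) ∧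
    (∃ b : ℝ, 0 < b ∧ ∀ υ ∈ vel υ₀, ∀ᵐ r ∂(volume.restrict (dom L)), φt' r υ = b * φt r υ) := by
  set A := pairing L υ₀ φt fun _ _ => 1 with hA
  set A' := pairing L υ₀ φt' fun _ _ => 1 with hA'
  have hA0 : 0 < A := h.pairing_one_pos hL
  have hA'0 : 0 < A' := h'.pairing_one_pos hL
  have hr0 : (0 : ℝ) ∈ dom L := ⟨by linarith, hL⟩
  have hv0 : υ₀ ∈ vel υ₀ := mem_vel.2 (Or.inr rfl)
  have hlam : lam' = lam := by
    have t1 := h.tendsto memLinftyPlus_one (fun _ _ _ _ => le_rfl) hr0 hv0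
    have t2 := h'.tendsto memLinftyPlus_one (fun _ _ _ _ => le_rfl) hr0 hv0
    have p1 := mul_pos (h.right_pos 0 hr0 υ₀ hv0) hA0
    have p2 := mul_pos (h'.right_pos 0 hr0 υ₀ hv0) hA'0
    -- the quotient of the two normalisations of `ψ t 1` is `exp ((lam - lam') t)`
    have t3 := t2.div t1 p1.ne'
    have h0 : lam - lam' = 0 := by
      refine eq_zero_of_tendsto_exp (div_pos p2 p1) (t3.congr' ?_)
      filter_upwards [Filter.Tendsto.eventually_const_lt p1 t1] with t ht
      have hX : ψ t (fun _ _ => 1) 0 υ₀ ≠ 0 := fun hX => by rw [hX, mul_zero] at ht; linarith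
      simp only [Pi.div_apply]
      rw [mul_div_mul_right _ _ hX, ← Real.exp_sub]
      ring_nf
    linarith
  subst hlam
  have hlim : ∀ g, MemLinftyPlus L υ₀ g → (∀ r ∈ dom L, ∀ v ∈ vel υ₀, g r v ≤ 1) →
      ∀ r ∈ dom L, ∀ v ∈ vel υ₀, φ' r v * pairing L υ₀ φt' g = φ r v * pairing L υ₀ φt g :=
    fun g hg hg1 r hr v hv =>
      tendsto_nhds_unique (h'.tendsto hg hg1 hr hv) (h.tendsto hg hg1 hr hv)
  have hright : ∀ r ∈ dom L, ∀ v ∈ vel υ₀, φ' r v = A / A' * φ r v := fun r hr v hv => by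
    have := hlim _ memLinftyPlus_one (fun _ _ _ _ => le_rfl) r hr v hv
    rw [div_mul_eq_mul_div, eq_div_iff hA'0.ne', this, mul_comm]
  have hleft : ∀ g, MemLinftyPlus L υ₀ g → (∀ r ∈ dom L, ∀ v ∈ vel υ₀, g r v ≤ 1) →
      pairing L υ₀ φt' g = A' / A * pairing L υ₀ φt g := fun g hg hg1 => by
    have h1 := hlim g hg hg1 0 hr0 υ₀ hv0
    rw [hright 0 hr0 υ₀ hv0] at h1
    have hφ := h.right_pos 0 hr0 υ₀ hv0
    field_simp at h1 ⊢
    linarith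
  refine ⟨rfl, ⟨A / A', div_pos hA0 hA'0, hright⟩, A' / A, div_pos hA'0 hA0, fun v hv => ?_⟩
  have hi : IntegrableOn (fun r => φt r v) (dom L) := by
    simpa using h.left_mem.integrableOn_mul memLinftyPlus_one hv
  have hi' : IntegrableOn (fun r => φt' r v) (dom L) := by
    simpa using h'.left_mem.integrableOn_mul memLinftyPlus_one hv
  refine Integrable.ae_eq_of_forall_setIntegral_eq _ _ hi' (hi.const_mul _) fun S hS _ => ?_
  classical
  have hpair : ∀ f : ℝ → ℝ → ℝ,
      pairing L υ₀ f (fun r w => if w = v then S.indicator 1 r else 0) =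
        ∫ r in S, f r v ∂(volume.restrict (dom L)) := fun f => by
    rw [pairing, Finset.sum_eq_single v]
    · rw [← integral_indicator hS]
      congr 1
      funext r
      by_cases hr : r ∈ S <;> simp [hr]
    · intro w _ hw
      simp [hw]
    · exact fun hv' => absurd hv hv'
  have hg := hleft (fun r w => if w = v then S.indicator 1 r else 0)
    ⟨fun w _ => ?_, fun r _ w _ => ?_, 1, fun r _ w _ => ?_⟩ fun r _ w _ => ?_
  · rw [hpair, hpair] at hg
    rw [hg, integral_const_mul]
  · by_cases hw : w = v
    · simp only [hw, if_true]
      exact (measurable_one.indicator hS).comp measurable_subtype_coe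
    · simp only [hw, if_false]
      exact measurable_const
  all_goals
    by_cases hw : w = v <;> by_cases hr : r ∈ S <;> simp [hw, hr]

end IsLeadEigentriple

/-! ### From a ground state to the leading eigentriple -/

theorem IsMildSemigroup.exists_trajectory (hψ : IsMildSemigroup L υ₀ σs σf ψ) (hυ₀ : 0 < υ₀)
    {g : ℝ → ℝ → ℝ} (hg : MemLinftyPlus L υ₀ g) :
    ∃ u, IsTrajectory L υ₀ σs 0 u ∧ (∀ r v, u 0 r v = zeroExt L υ₀ g r v) ∧
      ∀ t, 0 ≤ t → ∀ r ∈ dom L, ∀ v ∈ vel υ₀,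
        ψ t g r v = Real.exp ((σf - σs) * t) * u t r v := by
  refine ⟨_, (hψ g hg).isTrajectory_gauged hυ₀, (hψ g hg).gauged_zero hυ₀,
    fun t ht r hr v hv => ?_⟩
  rw [gauged, if_pos ht, zeroExt_of_mem hr hv, ← mul_assoc, ← Real.exp_add,
    show (σf - σs) * t + -(σf - σs) * t = 0 by ring, Real.exp_zero, one_mul]

theorem exists_isMildSemigroup (hυ₀ : 0 < υ₀) (hσs : 0 < σs) :
    ∃ ψ, IsMildSemigroup L υ₀ σs σf ψ := by
  have h : ∀ g, ∃ u, MemLinftyPlus L υ₀ g → IsMildSolution L υ₀ σs σf g u := fun g => by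
    by_cases hg : MemLinftyPlus L υ₀ g
    · obtain ⟨C, hC⟩ := hg.bounded
      obtain ⟨u, hu, hu0, -⟩ := exists_isTrajectory hσs (g := zeroExt L υ₀ g) (C := |C|)
        (fun r v h => zeroExt_of_not_mem h) hg.measurable_zeroExt hg.zeroExt_nonneg fun r v => by
          by_cases h : r ∈ dom L ∧ v ∈ vel υ₀
          · rw [zeroExt_of_mem h.1 h.2]
            exact (hC r h.1 v h.2).trans (le_abs_self C)
          · rw [zeroExt_of_not_mem h]
            exact abs_nonneg C
      exact ⟨_, fun _ => hu.isMildSolution (σf := σf) hυ₀ fun r hr v hv => by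
        rw [hu0, zeroExt_of_mem hr hv]⟩
    · exact ⟨fun _ _ _ => 0, fun h => absurd h hg⟩
  choose u hu using h
  exact ⟨fun t g => u g t, fun g hg => hu g hg⟩

/-- A ground state and its velocity reversal, suitably normalised, form the leading eigentriple. -/
theorem IsGroundState.leadEigentripleIs (hL : 0 < L) (hυ₀ : 0 < υ₀) (hσs : 0 < σs)
    (hψ : IsMildSemigroup L υ₀ σs σf ψ) {χ χt : ℝ → ℝ → ℝ}
    (hφ : IsGroundState L υ₀ σs β (zeroExt L υ₀ χ)) (hχt : ∀ r v, χt r v = χ r (-v)) :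
    LeadEigentripleIs L υ₀ ψ (σf - σs + β) χ χt := by
  have hpos : ∀ r ∈ dom L, ∀ v ∈ vel υ₀, 0 < χ r v := fun r hr v hv => by
    have := hφ.pos hυ₀ hr hv
    rwa [zeroExt_of_mem hr hv] at this
  have hχ : MemLinftyPlus L υ₀ χ := by
    refine ⟨fun v hv => ?_, fun r hr v hv => (hpos r hr v hv).le, ?_⟩
    · have h1 : Measurable fun r => zeroExt L υ₀ χ r v := by
        simpa using hφ.traj.measurable_at 0 v
      have h2 : (fun r : dom L => χ r v) = fun r : dom L => zeroExt L υ₀ χ r v :=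
        funext fun r => (zeroExt_of_mem r.2 hv).symm
      rw [h2]
      exact h1.comp measurable_subtype_coe
    · obtain ⟨C, hC⟩ := hφ.traj.bdd 0
      refine ⟨C, fun r hr v hv => ?_⟩
      have := (le_abs_self _).trans (hC 0 ⟨le_rfl, le_rfl⟩ r v)
      simpa [zeroExt_of_mem hr hv] using this
  have hχtmem : MemLinftyPlus L υ₀ χt := by
    obtain ⟨C, hC⟩ := hχ.bounded
    refine ⟨fun v hv => ?_, fun r hr v hv => ?_, C, fun r hr v hv => ?_⟩
    · simp only [hχt]; exact hχ.measurable _ (neg_mem_vel.2 hv)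
    · rw [hχt]; exact hχ.nonneg r hr _ (neg_mem_vel.2 hv)
    · rw [hχt]; exact hC r hr _ (neg_mem_vel.2 hv)
  have haway : ∀ K : Set ℝ, IsCompact K → K ⊆ dom L →
      ∃ c : ℝ, 0 < c ∧ ∀ r ∈ K, ∀ v ∈ vel υ₀, c ≤ χ r v := by
    intro K hK hKD
    obtain ⟨a, ha, hle⟩ := hφ.lower
    rcases K.eq_empty_or_nonempty with rfl | hne
    · exact ⟨1, one_pos, fun r hr => absurd hr (notMem_empty r)⟩
    · obtain ⟨x, hx, hmax⟩ := hK.exists_isMaxOn hne continuous_abs.continuousOn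
      have hxL : |x| < L := abs_lt.2 (hKD hx)
      refine ⟨a * ((L - |x|) / υ₀), mul_pos ha (div_pos (by linarith) hυ₀), fun r hr v hv => ?_⟩
      have h1 := hle r (hKD hr) v hv
      rw [zeroExt_of_mem (hKD hr) hv] at h1
      refine le_trans ?_ h1
      have h2 : |r| ≤ |x| := hmax hr
      gcongr
      rcases mem_vel.1 hv with rfl | rfl
      · rw [timeToExit_left hυ₀]; gcongr; linarith [neg_abs_le r]
      · rw [timeToExit_right hυ₀]; gcongr; linarith [le_abs_self r]
  set Z := pairing L υ₀ χt χ with hZ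
  have hvol : (volume : Measure ℝ) (dom L) = ENNReal.ofReal (2 * L) := by
    rw [dom, Real.volume_Ioo]; ring_nf
  have hZ0 : 0 < Z := by
    refine Finset.sum_pos (fun v hv => ?_) ⟨υ₀, mem_vel.2 (Or.inr rfl)⟩
    rw [setIntegral_pos_iff_support_of_nonneg_ae]
    · refine lt_of_lt_of_le ?_ (measure_mono (s := dom L) fun r hr => ⟨?_, hr⟩)
      · rw [hvol]; exact ENNReal.ofReal_pos.2 (by linarith)
      · rw [Function.mem_support, hχt]
        exact (mul_pos (hpos r hr _ (neg_mem_vel.2 hv)) (hpos r hr v hv)).ne'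
    · refine (ae_restrict_iff' measurableSet_dom).2 (Filter.Eventually.of_forall fun r hr => ?_)
      exact mul_nonneg (hχtmem.nonneg r hr v hv) (hχ.nonneg r hr v hv)
    · exact hχtmem.integrableOn_mul hχ hv
  have hc : 0 < Z⁻¹ := inv_pos.2 hZ0
  have hpc : ∀ g, pairing L υ₀ (fun r v => Z⁻¹ * χt r v) g = Z⁻¹ * pairing L υ₀ χt g := fun g => by
    simp only [pairing, mul_assoc, integral_const_mul, Finset.mul_sum]
  have hψpair : ∀ {g : ℝ → ℝ → ℝ} {u : ℝ → ℝ → ℝ → ℝ} {t : ℝ}, (∀ r ∈ dom L, ∀ v ∈ vel υ₀,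
      ψ t g r v = Real.exp ((σf - σs) * t) * u t r v) →
      pairing L υ₀ χt (ψ t g) = Real.exp ((σf - σs) * t) * pairing L υ₀ χt (u t) := by
    intro g u t h
    rw [pairing_congr (fun _ _ _ _ => rfl) h]
    simp only [pairing, mul_left_comm _ (Real.exp _), integral_const_mul, Finset.mul_sum]
  have hrev : ∀ r ∈ dom L, ∀ v ∈ vel υ₀, zeroExt L υ₀ χ r (-v) = χt r v := fun r hr v hv => by
    rw [zeroExt_of_mem hr (neg_mem_vel.2 hv), hχt]
  have hleft : ∀ {u : ℝ → ℝ → ℝ → ℝ}, IsTrajectory L υ₀ σs 0 u → (∀ r v, 0 ≤ u 0 r v) →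
      ∀ {t : ℝ}, 0 ≤ t →
      pairing L υ₀ χt (u t) = Real.exp (β * t) * pairing L υ₀ χt (u 0) := by
    intro u hu h0 t ht
    have := hφ.left_eigen hυ₀ hσs hu h0 ht
    rwa [pairing_congr hrev fun _ _ _ _ => rfl, pairing_congr hrev fun _ _ _ _ => rfl] at this
  have hexp : ∀ t, Real.exp ((σf - σs + β) * t) =
      Real.exp ((σf - σs) * t) * Real.exp (β * t) := fun t => by rw [← Real.exp_add]; ring_nf
  have hmain : IsLeadEigentriple L υ₀ ψ (σf - σs + β) χ (fun r v => Z⁻¹ * χt r v) := by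
    refine ⟨hχ, ⟨fun v hv => (hχtmem.measurable v hv).const_mul _, fun r hr v hv =>
      mul_nonneg hc.le (hχtmem.nonneg r hr v hv), ?_⟩, hpos, haway, ?_, ?_, ?_, ?_⟩
    · obtain ⟨C, hC⟩ := hχtmem.bounded
      exact ⟨Z⁻¹ * C, fun r hr v hv => mul_le_mul_of_nonneg_left (hC r hr v hv) hc.le⟩
    · intro K hK hKD
      obtain ⟨c, hc0, hle⟩ := haway K hK hKD
      refine ⟨Z⁻¹ * c, mul_pos hc hc0, fun v hv => ?_⟩
      refine (ae_restrict_iff' hK.measurableSet).2 (Filter.Eventually.of_forall fun r hr => ?_)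
      rw [hχt]
      exact mul_le_mul_of_nonneg_left (hle r hr _ (neg_mem_vel.2 hv)) hc.le
    · intro t ht r hr v hv
      obtain ⟨u, hu, hu0, hψu⟩ := hψ.exists_trajectory hυ₀ hχ
      rw [hψu t ht r hr v hv, hu.unique hσs hφ.traj (fun r v => by simp [hu0]) ht,
        zeroExt_of_mem hr hv, hexp, mul_assoc]
    · intro g hg t ht
      obtain ⟨u, hu, hu0, hψu⟩ := hψ.exists_trajectory hυ₀ hg
      rw [hpc, hpc, hψpair (hψu t ht), hleft hu (fun r v => by
        rw [hu0]; exact hg.zeroExt_nonneg r v) ht, hexp,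
        pairing_congr (f := χt) (g := u 0) (fun _ _ _ _ => rfl) fun r hr v hv => by
          rw [hu0, zeroExt_of_mem hr hv]]
      ring
    · obtain ⟨ε, C, t₀, hε, ht₀, hbt⟩ := hφ.exists_between hL hυ₀ hσs
      refine ⟨ε, hε, C, t₀, fun t ht g hg hg1 r hr v hv => ?_⟩
      have ht0 : 0 ≤ t := ht₀.trans ht
      obtain ⟨u, hu, hu0, hψu⟩ := hψ.exists_trajectory hυ₀ hg
      have hunn : ∀ r v, 0 ≤ u 0 r v := fun r v => by rw [hu0]; exact hg.zeroExt_nonneg r v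
      obtain ⟨m, M, hB, hle⟩ := hbt u hu hunn (fun r v => by
        rw [hu0]
        by_cases h : r ∈ dom L ∧ v ∈ vel υ₀
        · rw [zeroExt_of_mem h.1 h.2]; exact hg1 r h.1 v h.2
        · rw [zeroExt_of_not_mem h]; exact zero_le_one) t ht
      have hE : 0 < Real.exp (β * t) := Real.exp_pos _
      have hB' : ∀ r ∈ dom L, ∀ v ∈ vel υ₀, m * (Real.exp (β * t) * χ r v) ≤ u t r v ∧
          u t r v ≤ M * (Real.exp (β * t) * χ r v) := fun r hr v hv => by
        have := hB r v
        rwa [zeroExt_of_mem hr hv] at this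
      -- the normalised solution and its limit both lie in `[m, M]`
      have hX : Real.exp (-(σf - σs + β) * t) * (χ r v)⁻¹ * ψ t g r v =
          u t r v / (Real.exp (β * t) * χ r v) := by
        have h1 : Real.exp (-(σf - σs + β) * t) = (Real.exp ((σf - σs + β) * t))⁻¹ := by
          rw [← Real.exp_neg]; ring_nf
        have := hpos r hr v hv
        rw [hψu t ht0 r hr v hv, h1, hexp]
        field_simp
      have hXB : m ≤ u t r v / (Real.exp (β * t) * χ r v) ∧
          u t r v / (Real.exp (β * t) * χ r v) ≤ M := by
        have h1 := mul_pos hE (hpos r hr v hv)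
        rw [le_div_iff₀ h1, div_le_iff₀ h1]
        exact hB' r hr v hv
      have hpair0 : pairing L υ₀ χt g = pairing L υ₀ χt (u 0) :=
        pairing_congr (fun _ _ _ _ => rfl) fun r hr v hv => by rw [hu0, zeroExt_of_mem hr hv]
      have hut : MemLinftyPlus L υ₀ (u t) := by
        obtain ⟨D, hD⟩ := hu.bdd t
        exact ⟨fun v _ => (hu.measurable_at t v).comp measurable_subtype_coe,
          fun r _ v _ => hu.nonneg hσs hunn ht0 r v, D, fun r _ v _ =>
            (le_abs_self _).trans (hD t ⟨ht0, le_rfl⟩ r v)⟩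
      have hZmul : ∀ k : ℝ, k * Real.exp (β * t) * Z = ∑ v ∈ vel υ₀, ∫ r in dom L,
          k * Real.exp (β * t) * (χt r v * χ r v) := fun k => by
        simp only [hZ, pairing, integral_const_mul, Finset.mul_sum]
      have hlo : m * Real.exp (β * t) * Z ≤ pairing L υ₀ χt (u t) := by
        rw [hZmul]
        refine Finset.sum_le_sum fun v hv => setIntegral_mono_on
          ((hχtmem.integrableOn_mul hχ hv).const_mul _) (hχtmem.integrableOn_mul hut hv)
          measurableSet_dom fun r hr => ?_
        have := mul_le_mul_of_nonneg_left (hB' r hr v hv).1 (hχtmem.nonneg r hr v hv)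
        linarith
      have hhi : pairing L υ₀ χt (u t) ≤ M * Real.exp (β * t) * Z := by
        rw [hZmul]
        refine Finset.sum_le_sum fun v hv => setIntegral_mono_on
          (hχtmem.integrableOn_mul hut hv) ((hχtmem.integrableOn_mul hχ hv).const_mul _)
          measurableSet_dom fun r hr => ?_
        have := mul_le_mul_of_nonneg_left (hB' r hr v hv).2 (hχtmem.nonneg r hr v hv)
        linarith
      rw [hleft hu hunn ht0, ← hpair0] at hlo hhi
      have hY : m ≤ Z⁻¹ * pairing L υ₀ χt g ∧ Z⁻¹ * pairing L υ₀ χt g ≤ M := by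
        rw [inv_mul_eq_div, le_div_iff₀ hZ0, div_le_iff₀ hZ0]
        constructor
        · exact le_of_mul_le_mul_left (by linarith) hE
        · exact le_of_mul_le_mul_left (by linarith) hE
      rw [hX, hpc]
      refine (abs_le.2 ⟨?_, ?_⟩).trans hle <;> linarith [hXB.1, hXB.2, hY.1, hY.2]
  refine ⟨⟨Z⁻¹, hc, hmain⟩, fun lam' φ' φt' h' => ?_⟩
  obtain ⟨h1, h2, b, hb, h3⟩ := hmain.unique hL h'
  refine ⟨h1, h2, b * Z⁻¹, mul_pos hb hc, fun v hv => ?_⟩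
  filter_upwards [h3 v hv] with r hr
  rw [hr, mul_assoc]

end Slab

namespace Slab

variable {L υ₀ σ σs σf β : ℝ} {p : ℝ → ℝ}

/-! ### Ground states from profiles -/

/-- The profile `p` of a ground state: the eigenvalue equation for `p r 1_{v = υ₀} +
p (-r) 1_{v = -υ₀}`, which is a nonlocal ordinary differential equation, with the absorbing boundary
condition at `L`. -/
structure IsProfile (L υ₀ σ β : ℝ) (p : ℝ → ℝ) : Prop where
  deriv : ∀ r, HasDerivAt p ((β * p r - σ * p (-r)) / υ₀) r
  zero : p L = 0
  lower : ∃ a, 0 < a ∧ ∀ r ∈ dom L, a * (L - r) ≤ p r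

theorem rightOf_right (hυ₀ : 0 < υ₀) (p : ℝ → ℝ) (r : ℝ) : rightOf υ₀ p r υ₀ = p r := by
  have : υ₀ ≠ -υ₀ := by linarith
  simp [rightOf, this]

theorem rightOf_left (hυ₀ : 0 < υ₀) (p : ℝ → ℝ) (r : ℝ) : rightOf υ₀ p r (-υ₀) = p (-r) := by
  have : -υ₀ ≠ υ₀ := by linarith
  simp [rightOf, this]

theorem leftOf_eq (p : ℝ → ℝ) (r v : ℝ) : leftOf υ₀ p r v = rightOf υ₀ p r (-v) := by
  simp only [leftOf, rightOf, neg_eq_iff_eq_neg, neg_neg]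
  ring

theorem neg_mem_dom {r : ℝ} (hr : r ∈ dom L) : -r ∈ dom L :=
  ⟨by linarith [hr.2], by linarith [hr.1]⟩

theorem indicator_dom_neg (f : ℝ → ℝ) (x : ℝ) :
    (dom L).indicator f (-x) = (dom L).indicator (fun x => f (-x)) x := by
  classical
  simp only [indicator_apply]
  exact if_congr ⟨fun h => by simpa using neg_mem_dom h, neg_mem_dom⟩ rfl rfl

namespace IsProfile

theorem continuous (hp : IsProfile L υ₀ σ β p) : Continuous p :=
  continuous_iff_continuousAt.2 fun r => (hp.deriv r).continuousAt

theorem exists_upper (hL : 0 < L) (hp : IsProfile L υ₀ σ β p) :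
    ∃ b, 0 < b ∧ ∀ r ∈ dom L, p r ≤ b * (L - r) := by
  have hc := hp.continuous
  obtain ⟨C, hC⟩ := (isCompact_Icc (a := -L) (b := L)).exists_bound_of_continuousOn
    (f := fun r => (β * p r - σ * p (-r)) / υ₀) (by fun_prop)
  refine ⟨|C| + 1, by positivity, fun r hr => ?_⟩
  have h := Convex.norm_image_sub_le_of_norm_hasDerivWithin_le
    (fun x (_ : x ∈ Icc (-L) L) => (hp.deriv x).hasDerivWithinAt) hC (convex_Icc _ _)
    (⟨by linarith, le_rfl⟩ : L ∈ Icc (-L) L) ⟨hr.1.le, hr.2.le⟩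
  rw [hp.zero, sub_zero, Real.norm_eq_abs, Real.norm_eq_abs, abs_sub_comm,
    abs_of_pos (sub_pos.2 hr.2)] at h
  have h1 := mul_le_mul_of_nonneg_right (le_abs_self C) (sub_pos.2 hr.2).le
  have h2 := le_abs_self (p r)
  have h3 := hr.2
  linarith

/-- The mild eigenvalue equation, in the coordinate `ρ = ± r` that increases along the path. It is
the fundamental theorem of calculus up to the exit from `D`, where `p` vanishes. -/
theorem mild (hυ₀ : 0 < υ₀) (hp : IsProfile L υ₀ σ β p) {ρ : ℝ} (hρ : ρ ∈ dom L)
    {t : ℝ} (ht : 0 ≤ t) :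
    Real.exp (β * t) * p ρ = (dom L).indicator p (ρ + υ₀ * t) +
      ∫ s in (0 : ℝ)..t, σ * (Real.exp (β * (t - s)) *
        (dom L).indicator (fun x => p (-x)) (ρ + υ₀ * s)) := by
  have hc := hp.continuous
  have hftc : ∀ b, ∫ s in (0 : ℝ)..b, σ * (Real.exp (β * (t - s)) * p (-(ρ + υ₀ * s))) =
      Real.exp (β * t) * p ρ - Real.exp (β * (t - b)) * p (ρ + υ₀ * b) := by
    intro b
    have hd : ∀ s, HasDerivAt (fun s => -(Real.exp (β * (t - s)) * p (ρ + υ₀ * s)))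
        (σ * (Real.exp (β * (t - s)) * p (-(ρ + υ₀ * s)))) s := fun s => by
      have h1 := (((hasDerivAt_id' s).const_sub t).const_mul β).exp
      have h2 : HasDerivAt (fun s => ρ + υ₀ * s) υ₀ s := by
        simpa using ((hasDerivAt_id' s).const_mul υ₀).const_add ρ
      have h3 := (hp.deriv (ρ + υ₀ * s)).comp s h2
      refine (h1.mul h3).neg.congr_deriv ?_
      simp only [Function.comp]
      field_simp
      ring
    rw [intervalIntegral.integral_eq_sub_of_hasDerivAt (fun s _ => hd s)
      ((by fun_prop : Continuous fun s : ℝ =>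
        σ * (Real.exp (β * (t - s)) * p (-(ρ + υ₀ * s)))).intervalIntegrable _ _)]
    simp only [sub_zero, mul_zero, add_zero]
    ring
  have hin : ∀ s, 0 ≤ s → ρ + υ₀ * s < L → ρ + υ₀ * s ∈ dom L := fun s hs h =>
    ⟨by linarith [hρ.1, mul_nonneg hυ₀.le hs], h⟩
  by_cases hlt : ρ + υ₀ * t < L
  · have h1 : ∫ s in (0 : ℝ)..t, σ * (Real.exp (β * (t - s)) *
        (dom L).indicator (fun x => p (-x)) (ρ + υ₀ * s)) =
        ∫ s in (0 : ℝ)..t, σ * (Real.exp (β * (t - s)) * p (-(ρ + υ₀ * s))) := by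
      refine intervalIntegral.integral_congr fun s hs => ?_
      rw [uIcc_of_le ht] at hs
      have h2 := mul_le_mul_of_nonneg_left hs.2 hυ₀.le
      simp only [indicator_of_mem (hin s hs.1 (by linarith))]
    rw [h1, hftc, indicator_of_mem (hin t ht hlt)]
    simp
  · set b := (L - ρ) / υ₀ with hb
    have hυb : υ₀ * b = L - ρ := by rw [hb]; field_simp
    have hb0 : 0 ≤ b := div_nonneg (by linarith [hρ.2]) hυ₀.le
    have hbt : b ≤ t := by rw [hb, div_le_iff₀ hυ₀]; linarith
    have hout : ∀ s, b ≤ s → ρ + υ₀ * s ∉ dom L := fun s hs h => by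
      have h2 := mul_le_mul_of_nonneg_left hs hυ₀.le
      linarith [h.2]
    set F : ℝ → ℝ := fun s => σ * (Real.exp (β * (t - s)) *
      (dom L).indicator (fun x => p (-x)) (ρ + υ₀ * s)) with hF
    have h1 : EqOn F (fun s => σ * (Real.exp (β * (t - s)) * p (-(ρ + υ₀ * s)))) (Ioo 0 b) := by
      intro s hs
      have h2 := mul_lt_mul_of_pos_left hs.2 hυ₀
      simp only [hF, indicator_of_mem (hin s hs.1.le (by linarith))]
    have h2 : EqOn F (fun _ => 0) (Icc b t) := by
      intro s hs
      simp only [hF, indicator_of_notMem (hout s hs.1), mul_zero]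
    have i1 : IntervalIntegrable F volume 0 b :=
      ((by fun_prop : Continuous fun s : ℝ =>
        σ * (Real.exp (β * (t - s)) * p (-(ρ + υ₀ * s)))).intervalIntegrable 0 b).congr_uIoo
        (by rw [uIoo_of_le hb0]; exact fun s hs => (h1 hs).symm)
    have i2 : IntervalIntegrable F volume b t :=
      (intervalIntegrable_const (c := (0 : ℝ))).congr_uIoo
        (by rw [uIoo_of_le hbt]; exact fun s hs => (h2 (Ioo_subset_Icc_self hs)).symm)
    rw [← intervalIntegral.integral_add_adjacent_intervals i1 i2,
      intervalIntegral.integral_congr_Ioo_of_le hb0 h1,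
      intervalIntegral.integral_congr_Ioo_of_le hbt fun s hs => h2 (Ioo_subset_Icc_self hs), hftc,
      indicator_of_notMem (hout t hbt), hυb, add_sub_cancel, hp.zero]
    simp

theorem isGroundState (hL : 0 < L) (hυ₀ : 0 < υ₀) (hp : IsProfile L υ₀ σ β p) :
    IsGroundState L υ₀ σ β (zeroExt L υ₀ (rightOf υ₀ p)) := by
  have hc := hp.continuous
  have hright : ∀ r, zeroExt L υ₀ (rightOf υ₀ p) r υ₀ = (dom L).indicator p r := fun r => by
    by_cases hr : r ∈ dom L
    · rw [zeroExt_of_mem hr (mem_vel.2 (Or.inr rfl)), rightOf_right hυ₀, indicator_of_mem hr]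
    · rw [zeroExt_of_not_mem fun h => hr h.1, indicator_of_notMem hr]
  have hleft : ∀ r, zeroExt L υ₀ (rightOf υ₀ p) r (-υ₀) = (dom L).indicator (fun r => p (-r)) r :=
    fun r => by
      by_cases hr : r ∈ dom L
      · rw [zeroExt_of_mem hr (mem_vel.2 (Or.inl rfl)), rightOf_left hυ₀, indicator_of_mem hr]
      · rw [zeroExt_of_not_mem fun h => hr h.1, indicator_of_notMem hr]
  have hout : ∀ r v, v ∉ vel υ₀ → zeroExt L υ₀ (rightOf υ₀ p) r v = 0 := fun r v hv =>
    zeroExt_of_not_mem fun h => hv h.2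
  obtain ⟨a, ha, hpa⟩ := hp.lower
  obtain ⟨b, hb, hpb⟩ := hp.exists_upper hL
  refine ⟨⟨fun t r v h => by rw [zeroExt_of_not_mem h, mul_zero], fun v => ?_, fun T => ?_,
    fun t ht r hr v => ?_⟩, ⟨a * υ₀, by positivity, fun r hr v hv => ?_⟩,
    ⟨b * υ₀, by positivity, fun r hr v hv => ?_⟩⟩
  · have h : Measurable fun r => zeroExt L υ₀ (rightOf υ₀ p) r v := by
      by_cases hv : v ∈ vel υ₀
      · rcases mem_vel.1 hv with rfl | rfl
        · simp only [hleft]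
          exact (hc.comp continuous_neg).measurable.indicator measurableSet_dom
        · simp only [hright]
          exact hc.measurable.indicator measurableSet_dom
      · simp only [hout _ v hv]
        exact measurable_const
    exact Measurable.mul (by fun_prop) (h.comp measurable_snd)
  · obtain ⟨C, hC⟩ := (isCompact_Icc (a := -L) (b := L)).exists_bound_of_continuousOn
      (f := p) hc.continuousOn
    obtain ⟨C', hC'⟩ := (isCompact_Icc (a := 0) (b := T)).exists_bound_of_continuousOn
      (f := fun t => Real.exp (β * t)) (by fun_prop)
    refine ⟨C' * |C|, fun t ht r v => ?_⟩
    rw [abs_mul]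
    have h0 : 0 ≤ C' := (norm_nonneg _).trans (hC' t ht)
    refine mul_le_mul (hC' t ht) ?_ (abs_nonneg _) h0
    by_cases h : r ∈ dom L ∧ v ∈ vel υ₀
    · rw [zeroExt_of_mem h.1 h.2]
      have h1 := neg_mem_dom h.1
      rcases mem_vel.1 h.2 with rfl | rfl
      · rw [rightOf_left hυ₀]
        exact (hC _ ⟨h1.1.le, h1.2.le⟩).trans (le_abs_self C)
      · rw [rightOf_right hυ₀]
        exact (hC _ ⟨h.1.1.le, h.1.2.le⟩).trans (le_abs_self C)
    · rw [zeroExt_of_not_mem h, abs_zero]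
      exact abs_nonneg C
  · simp only [mul_zero, Real.exp_zero, one_mul, zero_mul, add_zero]
    by_cases hv : v ∈ vel υ₀
    · rcases mem_vel.1 hv with rfl | rfl
      · have h := hp.mild hυ₀ (neg_mem_dom hr) ht
        have e : ∀ s, -r + υ₀ * s = -(r + -υ₀ * s) := fun s => by ring
        simp only [neg_neg, hright, hleft, indicator_of_mem hr] at h ⊢
        simp only [e, indicator_dom_neg, neg_neg] at h
        exact h
      · have h := hp.mild hυ₀ hr ht
        simp only [hright, hleft, indicator_of_mem hr]
        exact h
    · simp only [hout _ v hv, hout _ (-v) fun h => hv (neg_mem_vel.1 h)]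
      simp
  · rw [zeroExt_of_mem hr hv]
    rcases mem_vel.1 hv with rfl | rfl
    · rw [rightOf_left hυ₀, timeToExit_left hυ₀]
      have h1 := hpa _ (neg_mem_dom hr)
      rw [sub_neg_eq_add] at h1
      refine le_of_eq_of_le ?_ h1
      field_simp
    · rw [rightOf_right hυ₀, timeToExit_right hυ₀]
      refine le_of_eq_of_le ?_ (hpa _ hr)
      field_simp
  · rw [zeroExt_of_mem hr hv]
    rcases mem_vel.1 hv with rfl | rfl
    · rw [rightOf_left hυ₀, timeToExit_left hυ₀]
      have h1 := hpb _ (neg_mem_dom hr)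
      rw [sub_neg_eq_add] at h1
      refine le_of_le_of_eq h1 ?_
      field_simp
    · rw [rightOf_right hυ₀, timeToExit_right hυ₀]
      refine le_of_le_of_eq (hpb _ hr) ?_
      field_simp

theorem leadEigentripleIs (hL : 0 < L) (hυ₀ : 0 < υ₀) (hσs : 0 < σs)
    {ψ : ℝ → (ℝ → ℝ → ℝ) → ℝ → ℝ → ℝ} (hψ : IsMildSemigroup L υ₀ σs σf ψ)
    (hp : IsProfile L υ₀ σs β p) :
    LeadEigentripleIs L υ₀ ψ (σf - σs + β) (rightOf υ₀ p) (leftOf υ₀ p) :=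
  (hp.isGroundState hL hυ₀).leadEigentripleIs hL hυ₀ hσs hψ (leftOf_eq p)

end IsProfile

/-! ### The equations for `x` and the three profiles -/

theorem tendsto_div_self_of_hasDerivAt_zero {f : ℝ → ℝ} (hf0 : f 0 = 0) (hf : HasDerivAt f 1 0) :
    Filter.Tendsto (fun x => f x / x) (nhdsWithin 0 (Ioi 0)) (nhds 1) := by
  have h := (hasDerivAt_iff_tendsto_slope.1 hf).mono_left
    (nhdsWithin_mono 0 fun x (hx : 0 < x) => hx.ne')
  refine h.congr fun x => ?_
  rw [slope_def_field, hf0, sub_zero, sub_zero]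

theorem strictConvexOn_sinh : StrictConvexOn ℝ (Ici 0) Real.sinh := by
  refine strictConvexOn_of_deriv2_pos (convex_Ici 0) Real.continuous_sinh.continuousOn
    fun x hx => ?_
  rw [interior_Ici] at hx
  simpa using hx

/-- The point `0` is not a solution, as `sinh 0 / 0` is `0` by convention. -/
theorem existsUnique_sinh_div {θ : ℝ} (hθ : 1 < θ) : ∃! x : ℝ, 0 ≤ x ∧ Real.sinh x / x = θ := by
  have hpos : ∀ x : ℝ, 0 ≤ x → Real.sinh x / x = θ → 0 < x := fun x hx h => by
    rcases hx.eq_or_lt with rfl | hx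
    · simp at h; linarith
    · exact hx
  have hlt : ∀ x y : ℝ, 0 < x → x < y → Real.sinh x / x < Real.sinh y / y := fun x y hx hxy => by
    have := strictConvexOn_sinh.secant_strict_mono (a := 0) (x := x) (y := y)
      (mem_Ici.2 le_rfl) (mem_Ici.2 hx.le) (mem_Ici.2 (hx.trans hxy).le) hx.ne' (hx.trans hxy).ne'
      hxy
    simpa using this
  obtain ⟨x, hx, hx1, hx0⟩ : ∃ x : ℝ, Real.sinh x / x < θ ∧ x < 1 ∧ 0 < x := by
    have h1 := (tendsto_div_self_of_hasDerivAt_zero Real.sinh_zero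
      (by simpa using Real.hasDerivAt_sinh 0)).eventually_lt_const hθ
    exact (h1.and ((Ioo_mem_nhdsGT one_pos))).exists.imp fun x hx => ⟨hx.1, hx.2.2, hx.2.1⟩
  have hy : θ ≤ Real.sinh (4 * θ) / (4 * θ) := by
    rw [le_div_iff₀ (by linarith), Real.sinh_eq]
    have h1 := Real.quadratic_le_exp_of_nonneg (show 0 ≤ 4 * θ by linarith)
    have h2 : Real.exp (-(4 * θ)) ≤ 1 := Real.exp_le_one_iff.2 (by linarith)
    nlinarith
  obtain ⟨z, hz, hzθ⟩ := intermediate_value_Icc (show x ≤ 4 * θ by linarith)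
    (f := fun x => Real.sinh x / x)
    (Real.continuous_sinh.continuousOn.div continuousOn_id fun w hw => (hx0.trans_le hw.1).ne')
    ⟨hx.le, hy⟩
  refine ⟨z, ⟨hx0.le.trans hz.1, hzθ⟩, fun y hy => ?_⟩
  have hz0 := hx0.trans_le hz.1
  have hy0 := hpos y hy.1 hy.2
  rcases lt_trichotomy y z with h | h | h
  · have := hlt y z hy0 h
    simp only at hzθ
    linarith [hy.2]
  · exact h
  · have := hlt z y hz0 h
    simp only at hzθ
    linarith [hy.2]

/-- The least solution lies in `(0, π)`, where the sine is concave and `sin x / x` decreases. The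
point `0` is not a solution, as `sin 0 / 0` is `0` by convention. -/
theorem exists_isLeast_sin_div {θ : ℝ} (hθ0 : 0 < θ) (hθ : θ < 1) :
    ∃ x : ℝ, x < Real.pi ∧ IsLeast {y : ℝ | 0 ≤ y ∧ Real.sin y / y = θ} x := by
  obtain ⟨x, hx, hx1, hx0⟩ : ∃ x : ℝ, θ < Real.sin x / x ∧ x < Real.pi ∧ 0 < x := by
    have h1 := (tendsto_div_self_of_hasDerivAt_zero Real.sin_zero
      (by simpa using Real.hasDerivAt_sin 0)).eventually_const_lt hθ
    exact (h1.and ((Ioo_mem_nhdsGT Real.pi_pos))).exists.imp fun x hx => ⟨hx.1, hx.2.2, hx.2.1⟩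
  obtain ⟨z, hz, hzθ⟩ := intermediate_value_Icc' hx1.le
    (f := fun x => Real.sin x / x)
    (Real.continuous_sin.continuousOn.div continuousOn_id fun w hw => (hx0.trans_le hw.1).ne')
    ⟨by simpa using hθ0.le, hx.le⟩
  simp only at hzθ
  have hz0 : 0 < z := hx0.trans_le hz.1
  have hzpi : z < Real.pi := by
    refine lt_of_le_of_ne hz.2 fun h => ?_
    rw [h, Real.sin_pi, zero_div] at hzθ
    exact hθ0.ne hzθ
  refine ⟨z, hzpi, ⟨hz0.le, hzθ⟩, fun y hy => ?_⟩
  by_contra hlt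
  rw [not_le] at hlt
  have hy0 : 0 < y := by
    rcases hy.1.eq_or_lt with h | h
    · have := hy.2
      rw [← h] at this
      simp at this; linarith
    · exact h
  have h := strictConcaveOn_sin_Icc.secant_strict_mono (a := 0) (x := y) (y := z)
    ⟨le_rfl, Real.pi_pos.le⟩ ⟨hy0.le, (hlt.trans hzpi).le⟩ ⟨hz0.le, hzpi.le⟩ hy0.ne' hz0.ne' hlt
  simp only [Real.sin_zero, sub_zero] at h
  linarith [hy.2]

theorem hasDerivAt_half_mul (x L r : ℝ) :
    HasDerivAt (fun r => 1 / 2 * x * (1 - r / L)) (-(x / (2 * L))) r := by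
  refine ((((hasDerivAt_id' r).div_const L).const_sub 1).const_mul (1 / 2 * x)).congr_deriv ?_
  ring

theorem half_mul_neg {L : ℝ} (x r : ℝ) :
    1 / 2 * x * (1 - -r / L) = x - 1 / 2 * x * (1 - r / L) := by ring

theorem isProfile_sinh (hL : 0 < L) (hυ₀ : 0 < υ₀) {x : ℝ} (hx : 0 < x)
    (h : υ₀ * x / (2 * L) = σ * Real.sinh x) :
    IsProfile L υ₀ σ (-(σ * Real.cosh x))
      (fun r => Real.sinh (1 / 2 * x * (1 - r / L)) / Real.sinh (1 / 2 * x)) := by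
  have hs : 0 < Real.sinh (1 / 2 * x) := Real.sinh_pos_iff.2 (by positivity)
  refine ⟨fun r => ?_, by simp [hL.ne'], x / (2 * L) / Real.sinh (1 / 2 * x), by positivity,
    fun r hr => ?_⟩
  · refine ((Real.hasDerivAt_sinh _).comp r (hasDerivAt_half_mul x L r)).div_const _
      |>.congr_deriv ?_
    rw [half_mul_neg, Real.sinh_sub]
    have h' : x / (2 * L) = σ * Real.sinh x / υ₀ := by rw [← h]; field_simp
    rw [h']
    field_simp
    ring
  · rw [div_mul_eq_mul_div]
    gcongr
    have h1 : x / (2 * L) * (L - r) = 1 / 2 * x * (1 - r / L) := by field_simp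
    rw [h1, Real.self_le_sinh_iff, ← h1]
    exact mul_nonneg (by positivity) (by linarith [hr.2])

theorem isProfile_one_sub (hL : 0 < L) (hυ₀ : 0 < υ₀) (h : υ₀ = 2 * L * σ) :
    IsProfile L υ₀ σ (-σ) (fun r => 1 - r / L) := by
  refine ⟨fun r => ?_, by simp [hL.ne'], 1 / L, by positivity, fun r _ => le_of_eq ?_⟩
  · refine (((hasDerivAt_id' r).div_const L).const_sub 1).congr_deriv ?_
    field_simp
    rw [h]
    ring
  · field_simp

theorem isProfile_sin (hL : 0 < L) (hυ₀ : 0 < υ₀) {x : ℝ} (hx : 0 < x) (hxpi : x < Real.pi)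
    (h : υ₀ * x / (2 * L) = σ * Real.sin x) :
    IsProfile L υ₀ σ (-(σ * Real.cos x))
      (fun r => Real.sin (1 / 2 * x * (1 - r / L)) / Real.sin (1 / 2 * x)) := by
  have hs : 0 < Real.sin (1 / 2 * x) := Real.sin_pos_of_pos_of_lt_pi (by positivity) (by linarith)
  have hsx : 0 < Real.sin x := Real.sin_pos_of_pos_of_lt_pi hx hxpi
  refine ⟨fun r => ?_, by simp [hL.ne'], Real.sin x / (2 * L) / Real.sin (1 / 2 * x),
    by positivity, fun r hr => ?_⟩
  · refine ((Real.hasDerivAt_sin _).comp r (hasDerivAt_half_mul x L r)).div_const _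
      |>.congr_deriv ?_
    rw [half_mul_neg, Real.sin_sub]
    have h' : x / (2 * L) = σ * Real.sin x / υ₀ := by rw [← h]; field_simp
    rw [h']
    field_simp
    ring
  · rw [div_mul_eq_mul_div]
    gcongr
    -- concavity of the sine on `[0, x]`
    have h0 : 0 ≤ (L - r) / (2 * L) := div_nonneg (by linarith [hr.2]) (by positivity)
    have h1 : (L - r) / (2 * L) ≤ 1 := by
      rw [div_le_one (by positivity)]; linarith [hr.1]
    have hcc := strictConcaveOn_sin_Icc.concaveOn.2
      (show x ∈ Icc 0 Real.pi from ⟨hx.le, hxpi.le⟩)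
      (show (0 : ℝ) ∈ Icc 0 Real.pi from ⟨le_rfl, Real.pi_pos.le⟩) h0
      (show 0 ≤ 1 - (L - r) / (2 * L) by linarith) (by ring)
    simp only [smul_eq_mul, Real.sin_zero, mul_zero, add_zero] at hcc
    have e : (L - r) / (2 * L) * x = 1 / 2 * x * (1 - r / L) := by field_simp
    rw [e] at hcc
    refine le_of_eq_of_le ?_ hcc
    ring

theorem sign_mul_abs (y : ℝ) : Real.sign y * |y| = y := by
  rcases lt_trichotomy y 0 with h | h | h
  · rw [Real.sign_of_neg h, abs_of_neg h]; ring
  · simp [h]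
  · rw [Real.sign_of_pos h, abs_of_pos h]; ring

end Slab

theorem mainTheorem11 (L υ₀ σs σf : ℝ) (hL : 0 < L) (hυ₀ : 0 < υ₀) (hσs : 0 < σs) (hσf : 0 < σf) :
    (∃ ψ : ℝ → (ℝ → ℝ → ℝ) → ℝ → ℝ → ℝ, Slab.IsMildSemigroup L υ₀ σs σf ψ) ∧
    ∀ ψ : ℝ → (ℝ → ℝ → ℝ) → ℝ → ℝ → ℝ, Slab.IsMildSemigroup L υ₀ σs σf ψ →
      (1 < υ₀ / (2 * L * σs) →
        (∃! x : ℝ, 0 ≤ x ∧ Real.sinh x / x = υ₀ / (2 * L * σs)) ∧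
        ∀ x : ℝ, 0 ≤ x → Real.sinh x / x = υ₀ / (2 * L * σs) →
          Slab.LeadEigentripleIs L υ₀ ψ
            (σf - σs - Real.sqrt (σs ^ 2 + (υ₀ * x / (2 * L)) ^ 2))
            (Slab.rightOf υ₀ (fun r => Real.sinh (1 / 2 * x * (1 - r / L)) / Real.sinh (1 / 2 * x)))
            (Slab.leftOf υ₀ (fun r => Real.sinh (1 / 2 * x * (1 - r / L)) / Real.sinh (1 / 2 * x)))) ∧
      (υ₀ / (2 * L * σs) = 1 →
        Slab.LeadEigentripleIs L υ₀ ψ (σf - 2 * σs)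
          (Slab.rightOf υ₀ (fun r => 1 - r / L))
          (Slab.leftOf υ₀ (fun r => 1 - r / L))) ∧
      (υ₀ / (2 * L * σs) < 1 →
        (∃ x : ℝ, IsLeast {y : ℝ | 0 ≤ y ∧ Real.sin y / y = υ₀ / (2 * L * σs)} x) ∧
        ∀ x : ℝ, IsLeast {y : ℝ | 0 ≤ y ∧ Real.sin y / y = υ₀ / (2 * L * σs)} x →
          Slab.LeadEigentripleIs L υ₀ ψ
            (σf - σs - Real.sign (Real.cos x) * Real.sqrt (σs ^ 2 - (υ₀ * x / (2 * L)) ^ 2))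
            (Slab.rightOf υ₀ (fun r => Real.sin (1 / 2 * x * (1 - r / L)) / Real.sin (1 / 2 * x)))
            (Slab.leftOf υ₀ (fun r => Real.sin (1 / 2 * x * (1 - r / L)) / Real.sin (1 / 2 * x)))) := by
  refine ⟨Slab.exists_isMildSemigroup hυ₀ hσs, fun ψ hψ => ⟨fun hθ => ?_, fun hθ => ?_, fun hθ => ?_⟩⟩
  · refine ⟨Slab.existsUnique_sinh_div hθ, fun x hx hxθ => ?_⟩
    have hx0 : 0 < x := by
      rcases hx.eq_or_lt with rfl | h
      · simp only [div_zero] at hxθ; linarith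
      · exact h
    have hB : υ₀ * x / (2 * L) = σs * Real.sinh x := by
      field_simp at hxθ ⊢
      linarith
    have hsqrt : Real.sqrt (σs ^ 2 + (υ₀ * x / (2 * L)) ^ 2) = σs * Real.cosh x := by
      have e : σs ^ 2 + (υ₀ * x / (2 * L)) ^ 2 = (σs * Real.cosh x) ^ 2 := by
        rw [hB, mul_pow, mul_pow, Real.cosh_sq]; ring
      rw [e, Real.sqrt_sq (mul_pos hσs (Real.cosh_pos x)).le]
    rw [hsqrt, sub_eq_add_neg (σf - σs)]
    exact (Slab.isProfile_sinh hL hυ₀ hx0 hB).leadEigentripleIs hL hυ₀ hσs hψ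
  · have h : υ₀ = 2 * L * σs := by rwa [div_eq_one_iff_eq (by positivity)] at hθ
    have e : σf - 2 * σs = σf - σs + -σs := by ring
    rw [e]
    exact (Slab.isProfile_one_sub hL hυ₀ h).leadEigentripleIs hL hυ₀ hσs hψ
  · have hθ0 : 0 < υ₀ / (2 * L * σs) := by positivity
    obtain ⟨z, hzpi, hz⟩ := Slab.exists_isLeast_sin_div hθ0 hθ
    refine ⟨⟨z, hz⟩, fun x hx => ?_⟩
    have hxz : x = z := hx.unique hz
    subst hxz
    have hxθ := hx.1.2
    have hx0 : 0 < x := by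
      rcases hx.1.1.eq_or_lt with h | h
      · rw [← h, div_zero] at hxθ; linarith
      · exact h
    have hB : υ₀ * x / (2 * L) = σs * Real.sin x := by
      field_simp at hxθ ⊢
      linarith
    have hsqrt : Real.sign (Real.cos x) * Real.sqrt (σs ^ 2 - (υ₀ * x / (2 * L)) ^ 2) =
        σs * Real.cos x := by
      have e : σs ^ 2 - (υ₀ * x / (2 * L)) ^ 2 = (σs * |Real.cos x|) ^ 2 := by
        rw [hB, mul_pow, mul_pow, sq_abs, Real.cos_sq']; ring
      rw [e, Real.sqrt_sq (mul_nonneg hσs.le (abs_nonneg _)), mul_left_comm, Slab.sign_mul_abs]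
    rw [hsqrt, sub_eq_add_neg (σf - σs)]
    exact (Slab.isProfile_sin hL hυ₀ hx0 hzpi hB).leadEigentripleIs hL hυ₀ hσs hψ
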